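/- A Datalog$^\exists$ program $\mathcal T$ is a finite set of tuple generating dependencies (TGDs) $\Phi(\bar x,\bar y)\Rightarrow\exists\bar z\,\Psi(\bar x,\bar z)$ over a finite relational signature $\Sigma$, where $\Phi$ and $\Psi$ are nonempty conjunctions of atoms without constants and equality; it is single-head if every $\Psi$ is a single atom. The Oblivious Chase of $\mathcal T$ on a finite database instance $D$ over $\Sigma$ starts with $D$ and creates, for each rule and each tuple $\bar a,\bar b$ of elements present that satisfies $\Phi(\bar a,\bar b)$, one tuple $\bar c$ of new elements and adds the atoms of $\Psi(\bar a,\bar c)$; the Semi-Oblivious Chase creates one such $\bar c$ for each rule and each $\bar a$ with $\exists\bar y\,\Phi(\bar a,\bar y)$. (A rule with empty $\bar z$ just adds the atoms of $\Psi(\bar a)$.) The chase terminates on $D$ if after finitely many rounds nothing new can be added. Let $D_\Sigma$ be the instance with a single element $a$ in which $R(a,\ldots,a)$ holds for every $R\in\Sigma$. **Theorem.** Consider programs consisting of single-head TGDs over signatures all of whose relations have arity $1$, $2$ or $3$. 1. There is no algorithm which, given such a program $\mathcal T$, decides whether the Oblivious Chase of $\mathcal T$ terminates on every finite database instance over its signature;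 and there is none for the Semi-Oblivious Chase. 2. Both problems are r.e.-hard under many-one reductions. Indeed, for every recursively enumerable set $P\subseteq\mathbb N$ there is a computable map $n\mapsto\mathcal T_n$ into such programs such that, for each of the two chase variants and all $n$: $n\in P$ if and only if the chase of $\mathcal T_n$ terminates on every finite database instance over its signature $\Sigma_n$, and $n\in P$ if and only if the chase of $\mathcal T_n$ terminates on the single instance $D_{\Sigma_n}$. -/

import Mathlib

namespace Chase

/-! ## Syntax: signatures, tuple generating dependencies, programs -/

/-- An atom `R(x₁, …, x_k)`: the number of a relation symbol and the list of the variables that are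
its arguments (variables are natural numbers). There are no constants and no equality. -/
abbrev Atom : Type := ℕ × List ℕ

/-- A tuple generating dependency `Φ(x̄, ȳ) ⇒ ∃ z̄, Ψ(x̄, z̄)`: a pair (body, head) of conjunctions of
atoms. The variables `x̄` are those that occur in both, `ȳ` those that occur only in the body, and
`z̄` (the existentially quantified ones) those that occur only in the head. -/
abbrev TGD : Type := List Atom × List Atom

/-- A Datalog∃ program: a finite signature, given as the list of the arities of the relation symbols
`0, 1, 2, …`, and a finite list of TGDs. -/
abbrev Program : Type := List ℕ × List TGD

namespace TGD

def body (r : TGD) : List Atom := r.1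

def head (r : TGD) : List Atom := r.2

/-- The variables `x̄, ȳ` of the body, without repetitions. -/
def bodyVars (r : TGD) : List ℕ := (r.body.flatMap Prod.snd).dedup

/-- The variables of the head, without repetitions. -/
def headVars (r : TGD) : List ℕ := (r.head.flatMap Prod.snd).dedup

/-- The variables `x̄` that the body shares with the head. -/
def frontier (r : TGD) : List ℕ := r.bodyVars.filter (fun x => x ∈ r.headVars)

end TGD

namespace Program

/-- The signature: `T.sig[i]` is the arity of the relation symbol number `i`. -/
def sig (T : Program) : List ℕ := T.1

def rules (T : Program) : List TGD := T.2

/-- Every rule has a nonempty body and a nonempty head, and every atom uses a relation symbol of the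
signature with the right number of arguments. -/
def WellFormed (T : Program) : Prop :=
  ∀ r ∈ T.rules, r.body ≠ [] ∧ r.head ≠ [] ∧
    ∀ a ∈ r.body ++ r.head, T.sig[a.1]? = some a.2.length

/-- Every head is a single atom. -/
def SingleHead (T : Program) : Prop :=
  ∀ r ∈ T.rules, r.head.length = 1

/-- The relation symbols are at most ternary (and none is nullary). -/
def TernarySig (T : Program) : Prop :=
  ∀ k ∈ T.sig, 1 ≤ k ∧ k ≤ 3

end Program

/-- The well-formed programs of single-head TGDs over an at most ternary signature. -/
def SingleHeadTernary (T : Program) : Prop :=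
  T.WellFormed ∧ T.SingleHead ∧ T.TernarySig

/-! ## Database instances -/

/-- A fact `R(a₁, …, a_k)` over the domain `α`. -/
abbrev Fact (α : Type) : Type := ℕ × List α

/-- `D` is a finite database instance over the signature `S`. -/
def IsInstance {C : Type} (S : List ℕ) (D : Set (Fact C)) : Prop :=
  D.Finite ∧ ∀ A ∈ D, S[A.1]? = some A.2.length

/-- The instance with a single element in which all atoms over the signature `S` are true. -/
def wellOfPositivity (S : List ℕ) : Set (Fact Unit) :=
  {A | S[A.1]? = some A.2.length}

/-! ## The chase -/

/-- The two eager versions of the chase: the Oblivious Chase creates one tuple of witnesses for each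
tuple `ā, b̄` with `Φ(ā, b̄)`, the Semi-Oblivious Chase one for each `ā` with `∃ ȳ, Φ(ā, ȳ)`. -/
inductive Variant : Type
  | oblivious
  | semiOblivious

/-- Elements of the chase: elements of the database instance, and terms `h_{i,z}(t₁, …, t_k)` that
name the witness created for the existential variable `z` of the rule number `i`. -/
inductive HTerm (C : Type) : Type
  | const (c : C) : HTerm C
  | skolem (i z k : ℕ) (args : Fin k → HTerm C) : HTerm C

/-- The variables on which the witnesses of a rule depend. -/
def Variant.skolemVars (v : Variant) (r : TGD) : List ℕ :=
  match v with
  | .oblivious => r.bodyVars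
  | .semiOblivious => r.frontier

/-- The extension of an assignment `σ` of the body variables of the rule `r` (which is the rule
number `i`) to its existential variables. -/
def extend {C : Type} (v : Variant) (i : ℕ) (r : TGD) (σ : ℕ → HTerm C) (x : ℕ) : HTerm C :=
  if x ∈ r.bodyVars then σ x
  else HTerm.skolem i x (v.skolemVars r).length (fun j => σ ((v.skolemVars r).get j))

/-- The fact that an atom becomes under an assignment of its variables. -/
def Atom.subst {α : Type} (σ : ℕ → α) (a : Atom) : Fact α := (a.1, a.2.map σ)

/-- One round of the chase: every rule is applied to every tuple that satisfies its body in `I`. A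
tuple that was served before gets the same witnesses again, hence nothing new. -/
def step {C : Type} (v : Variant) (T : Program) (I : Set (Fact (HTerm C))) :
    Set (Fact (HTerm C)) :=
  I ∪ {A | ∃ (i : ℕ) (r : TGD) (σ : ℕ → HTerm C), T.rules[i]? = some r ∧
    (∀ a ∈ r.body, Atom.subst σ a ∈ I) ∧
    ∃ a ∈ r.head, A = Atom.subst (extend v i r σ) a}

/-- The facts present after `n` rounds of the chase on the instance `D`. -/
def stage {C : Type} (v : Variant) (T : Program) (D : Set (Fact C)) : ℕ → Set (Fact (HTerm C))
  | 0 => {A | ∃ B ∈ D, A = (B.1, B.2.map HTerm.const)}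
  | n + 1 => step v T (stage v T D n)

/-- The chase terminates on `D`: after finitely many rounds nothing new can be added. -/
def TerminatesOn {C : Type} (v : Variant) (T : Program) (D : Set (Fact C)) : Prop :=
  ∃ n : ℕ, stage v T D (n + 1) = stage v T D n

/-- All-instances termination: the chase terminates on every finite database instance over the
signature of the program. -/
def AllInstancesTerminate (v : Variant) (T : Program) : Prop :=
  ∀ (C : Type) (D : Set (Fact C)), IsInstance T.sig D → TerminatesOn v T D

/-! ## Decision problems -/

/-- Some algorithm, given an input from the class `K`, decides whether it has the property `P`. -/
def DecidableOn {α : Type} [Primcodable α] (K P : α → Prop) : Prop :=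
  ∃ Q : α → Prop, ComputablePred Q ∧ ∀ x, K x → (Q x ↔ P x)

end Chase

/-! An r.e. set is the halting set of a counter machine `M` (`exists_machine_of_rePred`), so it
suffices to build, for each input `n`, a program whose chase terminates exactly when `M` halts on
`n`. Only `extendRule` creates elements. Started on the one-element instance, it can only build a
chain `chain 0, chain 1, …`, where `chain k` gets a successor once the fact `good` has been derived
for it.

Binary relations do not suffice because every fact of the simulation carries, as first argument, the
element `z` from which it is seen. Seen from `chain k`, that element is the number 0, its
predecessor is 1, and so on down to `chain 0`, which is the number `k`. In the critical instance
`chain 0` is its own predecessor, so arithmetic is truncated at `k`: the successor of the largest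
number is itself. Counting backwards provides each new element with a zero of its own and a fresh
copy of the numbers, so the facts that hold indiscriminately at `chain 0` do not contaminate it.
Datalog rules then simulate `M` with these numbers as times and register contents, and derive `good`
if `M` is in a running state at the largest number.

If `M` does not halt, every truncated simulation reaches its last number in a running state, and the
chain grows forever (`good_of_not_halts`, `not_terminatesOn_of_not_halts`). If `M` halts at time
`h`, then for `B > n + h + 1` the simulation seen from `chain B` ends before truncation is felt; the
intended meaning `Sem` is an invariant of the rules there, `good` is false, and the chain stops
(`stage_subset_bounded`). Nothing needs to be known about views from shorter elements.

An arbitrary instance reduces to the critical one by mapping all its constants to a single one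
(`collapse_mem_stage`); over finitely many constants only finitely many terms lie above a bounded
chain. Both chase variants agree since the sole existential rule has a single body variable, which
is also its frontier. -/

namespace CounterMachine

open Function

/-! ### Counter machines and structured program fragments -/

/-- Instructions of a counter machine: increment a register; jump forward if a register is zero
and decrement it otherwise; jump back. All jumps are relative. -/
inductive Ins : Type
  | inc (r : ℕ)
  | dz (r f : ℕ)
  | back (b : ℕ)

/-- A configuration: the instruction pointer and the contents of the registers. -/
abbrev Cfg : Type := ℕ × (ℕ → ℕ)

/-- The effect of an instruction. -/
def Ins.exec : Ins → Cfg → Cfg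
  | .inc r, (q, s) => (q + 1, update s r (s r + 1))
  | .dz r f, (q, s) => if s r = 0 then (q + f, s) else (q + 1, update s r (s r - 1))
  | .back b, (q, s) => (q - b, s)

/-- One step of the machine; configurations outside of the program are fixed. -/
def next (M : List Ins) (c : Cfg) : Cfg :=
  match M[c.1]? with
  | none => c
  | some i => i.exec c

/-- The program `M` contains `p` from address `a` on. -/
def At (M : List Ins) (a : ℕ) (p : List Ins) : Prop :=
  ∀ i < p.length, M[a + i]? = p[i]?

/-- Started at its beginning, the program fragment `p` transforms `s` to `s'` and reaches its end. -/
def Run (p : List Ins) (s s' : ℕ → ℕ) : Prop :=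
  ∀ M a, At M a p → ∃ j, (next M)^[j] (a, s) = (a + p.length, s')

theorem At.left {M a p q} (h : At M a (p ++ q)) : At M a p := by
  intro i hi
  rw [h i (by simp; omega), List.getElem?_append_left hi]

theorem At.right {M a p q} (h : At M a (p ++ q)) : At M (a + p.length) q := by
  intro i hi
  rw [add_assoc, h (p.length + i) (by simp; omega), List.getElem?_append_right (by omega)]
  simp

theorem At.next_eq {M a p} (h : At M a p) (j : ℕ) (i : Ins) (hj : p[j]? = some i) (s : ℕ → ℕ) :
    next M (a + j, s) = i.exec (a + j, s) := by
  have hl : j < p.length := by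
    by_contra hl
    rw [List.getElem?_eq_none (by omega)] at hj
    cases hj
  simp only [next]
  rw [h j hl, hj]

theorem Run.nil (s : ℕ → ℕ) : Run [] s s := fun _ _ _ => ⟨0, rfl⟩

theorem Run.append {p q s s' s''} (hp : Run p s s') (hq : Run q s' s'') : Run (p ++ q) s s'' := by
  intro M a h
  obtain ⟨j, hj⟩ := hp M a h.left
  obtain ⟨k, hk⟩ := hq M _ h.right
  refine ⟨k + j, ?_⟩
  rw [iterate_add_apply, hj, hk, List.length_append, add_assoc]

theorem Run.inc (r : ℕ) (s : ℕ → ℕ) : Run [.inc r] s (update s r (s r + 1)) := by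
  intro M a h
  exact ⟨1, h.next_eq 0 (.inc r) rfl s⟩

/-- While the register `r` is positive, decrement it and execute `p`. -/
def loop (r : ℕ) (p : List Ins) : List Ins :=
  [.dz r (p.length + 2)] ++ p ++ [.back (p.length + 1)]

theorem loop_length (r : ℕ) (p : List Ins) : (loop r p).length = p.length + 2 := by
  simp [loop]

theorem Run.loop_zero {r p s} (h0 : s r = 0) : Run (loop r p) s s := by
  intro M a h
  refine ⟨1, ?_⟩
  have := h.next_eq 0 (.dz r (p.length + 2)) rfl s
  simpa [Ins.exec, h0, loop_length] using this

/-- The exponent `j + 1` records that a round takes at least one step; the search machine needs this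
to see that its rounds happen at unbounded times. -/
theorem loop_iterate {r p s s' k} (hk : s r = k + 1) (hp : Run p (update s r k) s') {M a}
    (h : At M a (loop r p)) : ∃ j, (next M)^[j + 1] (a, s) = (a, s') := by
  have h1 := h.next_eq 0 (.dz r (p.length + 2)) rfl s
  obtain ⟨j, hj⟩ := hp M (a + 1) h.left.right
  have h2 := h.next_eq (p.length + 1) (.back (p.length + 1)) (by simp [loop]) s'
  refine ⟨j + 1, ?_⟩
  rw [iterate_succ_apply]
  have h1' : next M (a, s) = (a + 1, update s r k) := by simpa [Ins.exec, hk] using h1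
  rw [h1', iterate_succ_apply', hj, add_assoc, add_comm 1, h2]
  simp [Ins.exec]

theorem Run.loop_succ {r p s s' s'' k} (hk : s r = k + 1) (hp : Run p (update s r k) s')
    (hl : Run (loop r p) s' s'') : Run (loop r p) s s'' := by
  intro M a h
  obtain ⟨j, hj⟩ := loop_iterate hk hp h
  obtain ⟨l, hl⟩ := hl M a h
  exact ⟨l + (j + 1), by rw [iterate_add_apply, hj, hl]⟩

/-- The rule for loops that run through the states `σ k, σ (k - 1), …, σ 0`. -/
theorem Run.loop_for {r p} (σ : ℕ → ℕ → ℕ) (hr : ∀ k, σ k r = k) (m : ℕ)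
    (hp : ∀ k < m, Run p (update (σ (k + 1)) r k) (σ k)) : Run (loop r p) (σ m) (σ 0) := by
  induction m with
  | zero => exact Run.loop_zero (hr 0)
  | succ m ih =>
    exact Run.loop_succ (hr _) (hp m (Nat.lt_succ_self m)) (ih fun k hk => hp k (by omega))

theorem Run.clear (r : ℕ) (s : ℕ → ℕ) : Run (loop r []) s (update s r 0) := by
  have := Run.loop_for (r := r) (p := []) (fun k => update s r k) (by simp) (s r)
    (fun k _ => by simpa using Run.nil _)
  simpa using this

/-- Move the contents of `r` to `o`. -/
theorem Run.move {r o : ℕ} (h : r ≠ o) (s : ℕ → ℕ) :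
    Run (loop r [.inc o]) s (update (update s r 0) o (s o + s r)) := by
  have := Run.loop_for (r := r) (p := [.inc o])
    (fun k => update (update s r k) o (s o + (s r - k))) (by simp [update_of_ne h]) (s r)
    (fun k hk => by
      convert Run.inc o _ using 1
      funext x
      simp only [update_apply]
      split_ifs <;> omega)
  convert this using 1 <;> simp

/-- Add the contents of `r` to `o`, using the empty register `t`. -/
def copy (r o t : ℕ) : List Ins := loop r [.inc t, .inc o] ++ loop t [.inc r]

theorem Run.copy {r o t : ℕ} (hro : r ≠ o) (hrt : r ≠ t) (hot : o ≠ t) (s : ℕ → ℕ)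
    (ht : s t = 0) : Run (copy r o t) s (update s o (s o + s r)) := by
  have h1 := Run.loop_for (r := r) (p := [.inc t] ++ [.inc o])
    (fun k => update (update (update s r k) t (s r - k)) o (s o + (s r - k)))
    (by simp [update_of_ne hro, update_of_ne hrt]) (s r)
    (fun k hk => by
      refine Run.append (Run.inc t _) ?_
      convert Run.inc o _ using 1
      funext x
      simp only [update_apply]
      split_ifs <;> omega)
  rw [Nat.sub_self, add_zero, Nat.sub_zero] at h1
  have e : update (update (update s r (s r)) t 0) o (s o) = s := by
    funext x
    simp only [update_apply]
    split_ifs <;> simp_all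
  rw [e] at h1
  have h2 := h1.append (Run.move hrt.symm _)
  have e' : update s o (s o + s r) = update (update (update (update (update s r 0) t (s r)) o
      (s o + s r)) t 0) r (update (update (update s r 0) t (s r)) o (s o + s r) r +
        update (update (update s r 0) t (s r)) o (s o + s r) t) := by
    funext x
    simp only [update_apply]
    split_ifs <;> simp_all
  rw [e']
  exact h2

/-! ### Compilation of primitive recursive functions -/

/-- The fragment `p` computes `f` from the registers `ρ` into the register `o`, if `o` and all
registers from `b` on are empty. -/
def Computes {n : ℕ} (f : List.Vector ℕ n → ℕ) (ρ : Fin n → ℕ) (o b : ℕ) (p : List Ins) : Prop :=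
  ∀ (s : ℕ → ℕ) (v : List.Vector ℕ n), (∀ i, s (ρ i) = v.get i) → s o = 0 →
    (∀ r, b ≤ r → s r = 0) → Run p s (update s o (f v))

/-- For every choice of the input, output and scratch registers some fragment computes `f`. -/
def Compilable {n : ℕ} (f : List.Vector ℕ n → ℕ) : Prop :=
  ∀ (ρ : Fin n → ℕ) (o b : ℕ), (∀ i, ρ i < b) → o < b → (∀ i, ρ i ≠ o) → ∃ p, Computes f ρ o b p

theorem compilable_zero : Compilable (n := 0) fun _ => 0 := by
  intro ρ o b _ _ _
  refine ⟨[], fun s v _ ho _ => ?_⟩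
  have e : update s o 0 = s := update_eq_self_iff.2 ho.symm
  simpa [e] using Run.nil s

theorem compilable_get {n : ℕ} (i : Fin n) : Compilable fun v : List.Vector ℕ n => v.get i := by
  intro ρ o b hb ho hne
  refine ⟨copy (ρ i) o b, fun s v hv h0 hs => ?_⟩
  have := Run.copy (hne i) (hb i).ne ho.ne s (hs b le_rfl)
  rwa [h0, zero_add, hv i] at this

theorem compilable_succ : Compilable (n := 1) fun v => v.head.succ := by
  intro ρ o b hb ho hne
  obtain ⟨p, hp⟩ := compilable_get (0 : Fin 1) ρ o b hb ho hne
  refine ⟨p ++ [.inc o], fun s v hv h0 hs => ?_⟩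
  convert (hp s v hv h0 hs).append (Run.inc o _) using 1
  simp

theorem exists_run_clear (b n : ℕ) :
    ∃ p, ∀ s : ℕ → ℕ, Run p s (fun r => if b ≤ r ∧ r < b + n then 0 else s r) := by
  induction n with
  | zero =>
    refine ⟨[], fun s => ?_⟩
    convert Run.nil s using 1
    funext r
    rw [if_neg (by omega)]
  | succ n ih =>
    obtain ⟨p, hp⟩ := ih
    refine ⟨p ++ loop (b + n) [], fun s => ?_⟩
    convert (hp s).append (Run.clear (b + n) _) using 1
    funext r
    simp only [update_apply]
    split_ifs <;> first | rfl | omega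

/-- The values of the inner functions are collected in the registers `b, …, b + n - 1`, with scratch
space from `b + n` on; after `f` has read them the block is cleared, so that only the output
register has changed. -/
theorem compilable_comp {m n : ℕ} {f : List.Vector ℕ n → ℕ} (g : Fin n → List.Vector ℕ m → ℕ)
    (hf : Compilable f) (hg : ∀ i, Compilable (g i)) :
    Compilable fun a => f (List.Vector.ofFn fun i => g i a) := by
  intro ρ o b hb ho hne
  have key : ∀ j ≤ n, ∃ p, ∀ (s : ℕ → ℕ) (v : List.Vector ℕ m), (∀ i, s (ρ i) = v.get i) →
      (∀ r, b ≤ r → s r = 0) → Run p s (fun r => if b ≤ r ∧ r < b + j then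
        -- The default `0` is never reached, since `r - b < j ≤ n` in this branch.
        (if h : r - b < n then g ⟨r - b, h⟩ v else 0) else s r) := by
    intro j
    induction j with
    | zero =>
      refine fun _ => ⟨[], fun s v _ _ => ?_⟩
      convert Run.nil s using 1
      funext r
      rw [if_neg (by omega)]
    | succ j ih =>
      intro hj
      obtain ⟨p, hp⟩ := ih (by omega)
      obtain ⟨q, hq⟩ := hg ⟨j, hj⟩ ρ (b + j) (b + n) (fun i => by have := hb i; omega) (by omega)
        (fun i => by have := hb i; omega)
      refine ⟨p ++ q, fun s v hv hs => ?_⟩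
      convert (hp s v hv hs).append (hq _ v ?_ ?_ ?_) using 1
      · funext r
        simp only [update_apply]
        by_cases hr : r = b + j
        · subst hr
          rw [if_pos (by omega), if_pos rfl]
          have e : b + j - b = j := by omega
          rw [dif_pos (by omega)]
          simp only [e]
        · rw [if_neg hr]
          by_cases hr' : b ≤ r ∧ r < b + j
          · rw [if_pos hr', if_pos (by omega)]
          · rw [if_neg hr', if_neg (by omega)]
      · intro i
        have := hb i
        rw [if_neg (by omega), hv]
      · rw [if_neg (by omega), hs _ (by omega)]
      · intro r hr
        rw [if_neg (by omega), hs _ (by omega)]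
  obtain ⟨p, hp⟩ := key n le_rfl
  obtain ⟨q, hq⟩ := hf (fun i => b + i) o (b + n) (fun i => by omega) (by omega)
    (fun i => by omega)
  obtain ⟨c, hc⟩ := exists_run_clear b n
  refine ⟨p ++ q ++ c, fun s v hv h0 hs => ?_⟩
  convert ((hp s v hv hs).append (hq _ (List.Vector.ofFn fun i => g i v) ?_ ?_ ?_)).append (hc _)
    using 1
  · funext r
    simp only [update_apply]
    by_cases hr : r = o
    · rw [if_pos hr, if_neg (by omega), if_pos hr]
    · rw [if_neg hr, if_neg hr]
      by_cases hr' : b ≤ r ∧ r < b + n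
      · rw [if_pos hr', hs _ hr'.1]
      · rw [if_neg hr', if_neg hr']
  · intro i
    have e : b + (i : ℕ) - b = i := by omega
    have hi := i.2
    simp only [e]
    rw [if_pos (by omega), dif_pos hi]
    simp
  · rw [if_neg (by omega), h0]
  · intro r hr
    rw [if_neg (by omega), hs _ (by omega)]

theorem compilable_prec {n : ℕ} {f : List.Vector ℕ n → ℕ} {g : List.Vector ℕ (n + 2) → ℕ}
    (hf : Compilable f) (hg : Compilable g) :
    Compilable fun v : List.Vector ℕ (n + 1) =>
      v.head.rec (f v.tail) fun y IH => g (y ::ᵥ IH ::ᵥ v.tail) := by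
  intro ρ o b hb ho hne
  obtain ⟨p, hp⟩ := hf (fun i => ρ i.succ) (b + 1) (b + 4)
    (fun i => by have := hb i.succ; omega) (by omega) (fun i => by have := hb i.succ; omega)
  obtain ⟨q, hq⟩ := hg (Fin.cons (b + 2) (Fin.cons (b + 1) fun i => ρ i.succ)) (b + 3) (b + 4)
    (by
      refine Fin.cases (by simp) (Fin.cases (by simp) fun i => ?_)
      have := hb i.succ
      simp only [Fin.cons_succ]
      omega)
    (by omega)
    (by
      refine Fin.cases (by simp) (Fin.cases (by simp) fun i => ?_)
      have := hb i.succ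
      simp only [Fin.cons_succ]
      omega)
  -- Register `b` holds the number of remaining rounds, `b + 1` the current value of the recursion,
  -- `b + 2` the number of completed rounds, and `b + 3` receives the value of `g`.
  refine ⟨copy (ρ 0) b (b + 1) ++ p ++
    loop b (q ++ loop (b + 1) [] ++ loop (b + 3) [.inc (b + 1)] ++ [.inc (b + 2)]) ++
    loop (b + 1) [.inc o] ++ loop (b + 2) [], fun s v hv h0 hs => ?_⟩
  have hb0 := hb 0
  set F : ℕ → ℕ := fun k => k.rec (f v.tail) fun y IH => g (y ::ᵥ IH ::ᵥ v.tail) with hF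
  set N := v.head with hN
  have hv0 : s (ρ 0) = N := by rw [hv 0, List.Vector.get_zero]
  -- The loop invariant: with `k` rounds to go, `N - k` rounds are done and the value is `F (N -
  -- k)`.
  let σ : ℕ → ℕ → ℕ := fun k => update (update (update s b k) (b + 1) (F (N - k))) (b + 2) (N - k)
  have hσ : ∀ k r, σ k r = if r = b + 2 then N - k else if r = b + 1 then F (N - k) else
      if r = b then k else s r := fun k r => by simp only [σ, update_apply]
  have h1 : Run (copy (ρ 0) b (b + 1)) s (update s b N) := by
    have := Run.copy (r := ρ 0) (o := b) (t := b + 1) (by omega) (by omega) (by omega) s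
      (hs _ (by omega))
    rwa [hs b le_rfl, zero_add, hv0] at this
  have h2 : Run p (update s b N) (σ N) := by
    convert hp (update s b N) v.tail ?_ ?_ ?_ using 1
    · funext r
      rw [hσ, Nat.sub_self]
      simp only [update_apply]
      split_ifs <;> first | omega | rfl | (subst r; exact (hs _ (by omega)).symm)
    · intro i
      have := hb i.succ
      change update s b N (ρ i.succ) = _
      rw [update_of_ne (by omega), hv, List.Vector.get_tail_succ]
    · rw [update_of_ne (by omega), hs _ (by omega)]
    · intro r hr
      rw [update_of_ne (by omega), hs _ (by omega)]
  have h3 : Run (loop b (q ++ loop (b + 1) [] ++ loop (b + 3) [.inc (b + 1)] ++ [.inc (b + 2)]))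
      (σ N) (σ 0) := by
    refine Run.loop_for σ (fun k => by simp [hσ]) N fun k hk => ?_
    have hq' := hq (update (σ (k + 1)) b k)
      ((N - (k + 1)) ::ᵥ F (N - (k + 1)) ::ᵥ v.tail) (by
        refine Fin.cases ?_ (Fin.cases ?_ fun i => ?_)
        · simp [hσ]
        · rw [List.Vector.get_cons_succ]
          simp [hσ]
        · have := hb i.succ
          simp only [Fin.cons_succ, List.Vector.get_cons_succ]
          rw [update_of_ne (by omega), hσ, if_neg (by omega), if_neg (by omega),
            if_neg (by omega), hv, List.Vector.get_tail_succ])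
      (by rw [update_of_ne (by omega), hσ, if_neg (by omega), if_neg (by omega),
            if_neg (by omega), hs _ (by omega)])
      (fun r hr => by rw [update_of_ne (by omega), hσ, if_neg (by omega), if_neg (by omega),
            if_neg (by omega), hs _ (by omega)])
    have hstep : g ((N - (k + 1)) ::ᵥ F (N - (k + 1)) ::ᵥ v.tail) = F (N - k) := by
      have e : N - k = (N - (k + 1)) + 1 := by omega
      rw [e]
    rw [hstep] at hq'
    convert ((hq'.append (Run.clear (b + 1) _)).append
      (Run.move (r := b + 3) (o := b + 1) (by omega) _)).append (Run.inc (b + 2) _) using 1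
    funext r
    simp only [update_apply, hσ]
    split_ifs <;> first | omega | rfl | (subst r; exact hs _ (by omega))
  convert (((h1.append h2).append h3).append
    (Run.move (r := b + 1) (o := o) (by omega) _)).append (Run.clear (b + 2) _) using 1
  funext r
  simp only [update_apply, hσ]
  split_ifs <;> first | omega | rfl | (subst r; exact hs _ (by omega)) |
    simp [h0, hF, ← hN]

theorem compilable_of_primrec' {n : ℕ} {f : List.Vector ℕ n → ℕ} (hf : Nat.Primrec' f) :
    Compilable f := by
  induction hf with
  | zero => exact compilable_zero
  | succ => exact compilable_succ
  | get i => exact compilable_get i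
  | comp g _ _ hf hg => exact compilable_comp g hf hg
  | prec _ _ hf hg => exact compilable_prec hf hg

/-! ### Machines for recursively enumerable sets -/

/-- The machine started with `n` in register `0`. -/
def start (n : ℕ) : Cfg := (0, update 0 0 n)

/-- The configuration at time `t` of the run on input `n`. -/
def trace (M : List Ins) (n t : ℕ) : Cfg := (next M)^[t] (start n)

/-- The machine halts on input `n`: it leaves its program. -/
def Halts (M : List Ins) (n : ℕ) : Prop := ∃ t, M[(trace M n t).1]? = none

theorem next_of_none {M : List Ins} {c : Cfg} (h : M[c.1]? = none) : next M c = c := by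
  simp [next, h]

theorem iterate_next_of_none {M : List Ins} {c : Cfg} (h : M[c.1]? = none) (j : ℕ) :
    (next M)^[j] c = c :=
  iterate_fixed (next_of_none h) j

/-- Counter machines can search for zeros of primitive recursive functions. -/
theorem exists_machine_search {g : List.Vector ℕ 2 → ℕ} (hg : Nat.Primrec' g) :
    ∃ M, ∀ n, Halts M n ↔ ∃ k, g (k ::ᵥ n ::ᵥ .nil) = 0 := by
  obtain ⟨p, hp⟩ := compilable_of_primrec' hg ![1, 0] 3 4 (by simp [Fin.forall_fin_two])
    (by omega) (by simp [Fin.forall_fin_two])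
  -- Register 0 holds the input, 1 the candidate `k`, 2 a flag that keeps the outer loop going, and
  -- 3 the value of `g`. The inner loop acts as a conditional: if the value is nonzero, it is
  -- cleared, the flag is set again and `k` grows.
  set body : List Ins := p ++ loop 3 (loop 3 [] ++ [.inc 2] ++ [.inc 1]) with hbody
  let M : List Ins := [.inc 2] ++ loop 2 body
  have hAt : At M 1 (loop 2 body) := by
    have : At M 0 ([.inc 2] ++ loop 2 body) := fun i _ => by rw [zero_add]
    exact this.right
  refine ⟨M, fun n => ?_⟩
  let σ : ℕ → ℕ → ℕ → ℕ := fun k fl => update (update (update 0 0 n) 1 k) 2 fl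
  have hσ : ∀ k fl r, σ k fl r = if r = 2 then fl else if r = 1 then k else if r = 0 then n else 0 :=
    fun k fl r => by simp only [σ, update_apply]; rfl
  have hfirst : trace M n 1 = (1, σ 0 1) := by
    refine Prod.ext rfl ?_
    funext r
    change update (update (0 : ℕ → ℕ) 0 n) 2 (update (0 : ℕ → ℕ) 0 n 2 + 1) r = σ 0 1 r
    rw [hσ]
    simp only [update_apply, Pi.zero_apply]
    split_ifs <;> simp_all
  have hp' : ∀ k, Run p (σ k 0) (update (σ k 0) 3 (g (k ::ᵥ n ::ᵥ .nil))) := by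
    refine fun k => hp (σ k 0) (k ::ᵥ n ::ᵥ .nil) ?_ ?_ ?_
    · rw [Fin.forall_fin_two]
      constructor
      · simp [hσ]
      · change σ k 0 0 = n
        simp [hσ]
    · simp [hσ]
    · intro r hr
      rw [hσ, if_neg (by omega), if_neg (by omega), if_neg (by omega)]
  have hupd : ∀ k, update (σ k 1) 2 0 = σ k 0 := by
    intro k
    funext r
    simp only [update_apply, hσ]
    split_ifs <;> rfl
  have hzero : ∀ k, g (k ::ᵥ n ::ᵥ .nil) = 0 → Run (loop 2 body) (σ k 1) (σ k 0) := by
    intro k hk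
    refine Run.loop_succ (k := 0) (s' := σ k 0) (by simp [hσ]) ?_ (Run.loop_zero (by simp [hσ]))
    rw [hupd]
    have h1 := hp' k
    have e : update (σ k 0) 3 0 = σ k 0 := by
      rw [update_eq_self_iff]
      simp [hσ]
    rw [hk, e] at h1
    exact h1.append (Run.loop_zero (by simp [hσ]))
  have hsucc : ∀ k, g (k ::ᵥ n ::ᵥ .nil) ≠ 0 → Run body (update (σ k 1) 2 0) (σ (k + 1) 1) := by
    intro k hk
    rw [hupd]
    obtain ⟨m, hm⟩ := Nat.exists_eq_succ_of_ne_zero hk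
    have h1 := hp' k
    rw [hm] at h1
    refine h1.append (Run.loop_succ (k := m) (s' := σ (k + 1) 1) (by simp)
      ?_ (Run.loop_zero (by simp [hσ])))
    convert ((Run.clear 3 _).append (Run.inc 2 _)).append (Run.inc 1 _) using 1
    funext r
    simp only [update_apply, hσ]
    split_ifs <;> omega
  have hloop : ∀ k, (∀ i < k, g (i ::ᵥ n ::ᵥ .nil) ≠ 0) →
      ∃ t, k ≤ t ∧ trace M n t = (1, σ k 1) := by
    intro k
    induction k with
    | zero => exact fun _ => ⟨1, by omega, hfirst⟩
    | succ k ih =>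
      intro h
      obtain ⟨t, ht, e⟩ := ih fun i hi => h i (by omega)
      obtain ⟨j, hj⟩ := loop_iterate (k := 0) (by simp [hσ]) (hsucc k (h k (by omega))) hAt
      refine ⟨j + 1 + t, by omega, ?_⟩
      rw [trace, iterate_add_apply]
      rw [trace] at e
      rw [e, hj]
  constructor
  · rintro ⟨t, ht⟩
    by_contra hcon
    push Not at hcon
    obtain ⟨t', hle, e⟩ := hloop t fun i _ => hcon i
    have : trace M n t' = trace M n t := by
      obtain ⟨d, rfl⟩ := Nat.exists_eq_add_of_le' hle
      rw [trace, iterate_add_apply]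
      exact iterate_next_of_none ht d
    rw [← this, e] at ht
    simp [M, loop] at ht
  · intro hex
    classical
    obtain ⟨t, -, e⟩ := hloop (Nat.find hex) fun i hi => Nat.find_min hex hi
    obtain ⟨j, hj⟩ := hzero _ (Nat.find_spec hex) M 1 hAt
    refine ⟨j + t, ?_⟩
    rw [trace, iterate_add_apply]
    rw [trace] at e
    rw [e, hj]
    simp [M, loop, add_comm]

/-- Every recursively enumerable set is the set of the inputs on which some counter machine
halts. -/
theorem exists_machine_of_rePred {p : ℕ → Prop} (hp : REPred p) :
    ∃ M, ∀ n, Halts M n ↔ p n := by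
  have hpart : Nat.Partrec fun n => Part.map (fun _ : Unit => (0 : ℕ)) (Part.assert (p n)
      fun _ => Part.some ()) :=
    Partrec.nat_iff.1 (Partrec.map hp (Computable.const 0).to₂)
  obtain ⟨c, hc⟩ := Nat.Partrec.Code.exists_code.1 hpart
  let g : ℕ → ℕ → ℕ := fun k n => if (c.evaln k n).isSome then 0 else 1
  have hg : Primrec₂ g := by
    have h1 : Primrec fun a : ℕ × ℕ => Nat.Partrec.Code.evaln a.1 c a.2 :=
      Nat.Partrec.Code.primrec_evaln.comp
        (Primrec.pair (Primrec.pair Primrec.fst (Primrec.const c)) Primrec.snd)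
    have h2 : Primrec fun a : ℕ × ℕ => (Nat.Partrec.Code.evaln a.1 c a.2).isSome :=
      Primrec.option_isSome.comp h1
    exact Primrec.ite (Primrec.eq.comp h2 (Primrec.const true)) (Primrec.const 0)
      (Primrec.const 1)
  obtain ⟨M, hM⟩ := exists_machine_search (Nat.Primrec'.prim_iff₂.2 hg)
  refine ⟨M, fun n => (hM n).trans ?_⟩
  have hdom : p n ↔ ∃ x, x ∈ c.eval n := by
    rw [hc]
    simp [Part.mem_assert_iff]
  rw [hdom]
  constructor
  · rintro ⟨k, hk⟩
    have hk' : (c.evaln k n).isSome := by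
      by_contra hcon
      simp [g, hcon] at hk
    obtain ⟨x, hx⟩ := Option.isSome_iff_exists.1 hk'
    exact ⟨x, Nat.Partrec.Code.evaln_sound hx⟩
  · rintro ⟨x, hx⟩
    obtain ⟨k, hk⟩ := Nat.Partrec.Code.evaln_complete.1 hx
    refine ⟨k, ?_⟩
    have : (c.evaln k n).isSome := Option.isSome_iff_exists.2 ⟨x, hk⟩
    simp [g, this]

end CounterMachine

namespace Chase

/-! ### General facts on the chase -/

section Generic

variable {C C' : Type} {v : Variant} {T : Program}

theorem stage_mono (D : Set (Fact C)) : Monotone (stage v T D) :=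
  monotone_nat_of_le_succ fun _ => Set.subset_union_left

theorem stage_subset {D : Set (Fact C)} {X : Set (Fact (HTerm C))}
    (h0 : ∀ B ∈ D, (B.1, B.2.map HTerm.const) ∈ X)
    (hs : ∀ (i : ℕ) (r : TGD) (σ : ℕ → HTerm C), T.rules[i]? = some r →
      (∀ a ∈ r.body, Atom.subst σ a ∈ X) → ∀ a ∈ r.head, Atom.subst (extend v i r σ) a ∈ X)
    (n : ℕ) : stage v T D n ⊆ X := by
  induction n with
  | zero =>
    rintro _ ⟨B, hB, rfl⟩
    exact h0 B hB
  | succ n ih =>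
    rintro A (hA | ⟨i, r, σ, hi, hb, a, ha, rfl⟩)
    · exact ih hA
    · exact hs i r σ hi (fun b hb' => ih (hb b hb')) a ha

/-- The union of all stages of the chase. -/
def result (v : Variant) (T : Program) (D : Set (Fact C)) : Set (Fact (HTerm C)) :=
  ⋃ n, stage v T D n

/-- Bodies are finite and stages increase, so the whole body already holds in a single stage. -/
theorem result_closed {D : Set (Fact C)} {i : ℕ} {r : TGD} {σ : ℕ → HTerm C}
    (hi : T.rules[i]? = some r) (hb : ∀ a ∈ r.body, Atom.subst σ a ∈ result v T D) {a : Atom}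
    (ha : a ∈ r.head) : Atom.subst (extend v i r σ) a ∈ result v T D := by
  have : ∀ l : List Atom, (∀ a ∈ l, Atom.subst σ a ∈ result v T D) →
      ∃ n, ∀ a ∈ l, Atom.subst σ a ∈ stage v T D n := by
    intro l
    induction l with
    | nil => exact fun _ => ⟨0, by simp⟩
    | cons b l ih =>
      intro hl
      obtain ⟨n, hn⟩ := ih fun a ha => hl a (List.mem_cons_of_mem _ ha)
      obtain ⟨m, hm⟩ := Set.mem_iUnion.1 (hl b List.mem_cons_self)
      refine ⟨max m n, fun a ha => ?_⟩
      rcases List.mem_cons.1 ha with rfl | ha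
      · exact stage_mono D (le_max_left m n) hm
      · exact stage_mono D (le_max_right m n) (hn a ha)
  obtain ⟨n, hn⟩ := this _ hb
  exact Set.mem_iUnion.2 ⟨n + 1, Or.inr ⟨i, r, σ, hi, hn, a, ha, rfl⟩⟩

theorem stage_eq_of_le {D : Set (Fact C)} {n : ℕ} (h : stage v T D (n + 1) = stage v T D n)
    {m : ℕ} (hm : n ≤ m) : stage v T D m = stage v T D n := by
  induction m, hm using Nat.le_induction with
  | base => rfl
  | succ m _ ih =>
    change step v T (stage v T D m) = _
    rw [ih]
    exact h

/-- The depth of a term is at most `m`. -/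
def HTerm.DepthLE : ℕ → HTerm C → Prop
  | _, .const _ => True
  | 0, .skolem _ _ _ _ => False
  | m + 1, .skolem _ _ _ args => ∀ j, HTerm.DepthLE m (args j)

theorem HTerm.DepthLE.succ {m : ℕ} {t : HTerm C} (h : t.DepthLE m) : t.DepthLE (m + 1) := by
  induction m generalizing t with
  | zero =>
    cases t with
    | const c => trivial
    | skolem => exact h.elim
  | succ m ih =>
    cases t with
    | const c => trivial
    | skolem i z k args => exact fun j => ih (h j)

theorem mem_skolemVars {r : TGD} {x : ℕ} (h : x ∈ v.skolemVars r) : x ∈ r.bodyVars := by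
  cases v with
  | oblivious => exact h
  | semiOblivious => exact List.mem_of_mem_filter h

theorem mem_bodyVars {r : TGD} {x : ℕ} : x ∈ r.bodyVars ↔ ∃ a ∈ r.body, x ∈ a.2 := by
  simp [TGD.bodyVars]

/-- A property of the body terms that passes to the created terms passes to the head. -/
theorem forall_extend {P Q : HTerm C → Prop} {i : ℕ} {r : TGD} {σ : ℕ → HTerm C}
    (hb : ∀ a ∈ r.body, ∀ t ∈ (Atom.subst σ a).2, P t) (hPQ : ∀ t, P t → Q t)
    (hsk : ∀ i z k args, (∀ j, P (args j)) → Q (.skolem i z k args)) (x : ℕ) :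
    Q (extend v i r σ x) := by
  have hv : ∀ y ∈ r.bodyVars, P (σ y) := by
    intro y hy
    obtain ⟨a, ha, hya⟩ := mem_bodyVars.1 hy
    exact hb a ha _ (List.mem_map_of_mem hya)
  unfold extend
  split_ifs with hx
  · exact hPQ _ (hv x hx)
  · exact hsk _ _ _ _ fun j => hv _ (mem_skolemVars (List.get_mem _ _))

theorem depthLE_of_mem_stage {D : Set (Fact C)} {n : ℕ} {A : Fact (HTerm C)}
    (hA : A ∈ stage v T D n) : ∀ t ∈ A.2, t.DepthLE n := by
  induction n generalizing A with
  | zero =>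
    obtain ⟨B, -, rfl⟩ := hA
    intro t ht
    obtain ⟨c, -, rfl⟩ := List.mem_map.1 ht
    trivial
  | succ n ih =>
    rcases hA with hA | ⟨i, r, σ, -, hb, a, -, rfl⟩
    · exact fun t ht => (ih hA t ht).succ
    · intro t ht
      obtain ⟨x, -, rfl⟩ := List.mem_map.1 ht
      exact forall_extend (P := HTerm.DepthLE n) (fun a ha t ht => ih (hb a ha) t ht)
        (fun t ht => ht.succ) (fun _ _ _ _ h => h) x

/-- All constants of the term belong to `S`. -/
def HTerm.Over (S : Set C) : HTerm C → Prop
  | .const c => c ∈ S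
  | .skolem _ _ _ args => ∀ j, HTerm.Over S (args j)

theorem over_of_mem_stage {D : Set (Fact C)} {S : Set C} (hS : ∀ B ∈ D, ∀ c ∈ B.2, c ∈ S)
    (n : ℕ) : stage v T D n ⊆ {A | ∀ t ∈ A.2, t.Over S} := by
  refine stage_subset ?_ ?_ n
  · intro B hB t ht
    obtain ⟨c, hc, rfl⟩ := List.mem_map.1 ht
    exact hS B hB c hc
  · intro i r σ _ hb a _ t ht
    obtain ⟨x, -, rfl⟩ := List.mem_map.1 ht
    exact forall_extend (P := HTerm.Over S) hb (fun _ h => h) (fun _ _ _ _ h => h) x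

theorem stage_wellFormed {D : Set (Fact C)} (hT : T.WellFormed)
    (hD : ∀ A ∈ D, T.sig[A.1]? = some A.2.length) (n : ℕ) :
    stage v T D n ⊆ {A | T.sig[A.1]? = some A.2.length} := by
  refine stage_subset ?_ ?_ n
  · intro B hB
    simpa using hD B hB
  · intro i r σ hi _ a ha
    have := (hT r (List.mem_of_getElem? hi)).2.2 a (List.mem_append_right _ ha)
    simpa [Atom.subst] using this

/-- The map on terms induced by the map of all constants to the single element of `Unit`. -/
def HTerm.collapse : HTerm C → HTerm Unit
  | .const _ => .const ()
  | .skolem i z k args => .skolem i z k fun j => (args j).collapse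

/-- The map on facts induced by `HTerm.collapse`. -/
def collapseFact (A : Fact (HTerm C)) : Fact (HTerm Unit) := (A.1, A.2.map HTerm.collapse)

theorem collapse_extend (i : ℕ) (r : TGD) (σ : ℕ → HTerm C) (x : ℕ) :
    (extend v i r σ x).collapse = extend v i r (fun y => (σ y).collapse) x := by
  unfold extend
  split_ifs <;> rfl

/-- The one-element instance with all facts is critical: every instance maps to it, and since
witnesses are terms built from the rule, the variable and the arguments alone, the map commutes with
chase steps round by round. -/
theorem collapse_mem_stage {D : Set (Fact C)} (hD : ∀ A ∈ D, T.sig[A.1]? = some A.2.length)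
    {n : ℕ} {A : Fact (HTerm C)} (hA : A ∈ stage v T D n) :
    collapseFact A ∈ stage v T (wellOfPositivity T.sig) n := by
  induction n generalizing A with
  | zero =>
    obtain ⟨B, hB, rfl⟩ := hA
    refine ⟨(B.1, B.2.map fun _ => ()), ?_, ?_⟩
    · simpa [wellOfPositivity] using hD B hB
    · simp only [collapseFact, List.map_map]
      rfl
  | succ n ih =>
    rcases hA with hA | ⟨i, r, σ, hi, hb, a, ha, rfl⟩
    · exact Or.inl (ih hA)
    · refine Or.inr ⟨i, r, fun y => (σ y).collapse, hi, fun b hb' => ?_, a, ha, ?_⟩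
      · simpa [collapseFact, Atom.subst, Function.comp_def] using ih (hb b hb')
      · simp [collapseFact, Atom.subst, Function.comp_def, collapse_extend]

/-- Otherwise the stages would be infinitely many distinct subsets of a finite set. -/
theorem terminatesOn_of_finite {D : Set (Fact C)} {X : Set (Fact (HTerm C))} (hX : X.Finite)
    (h : ∀ n, stage v T D n ⊆ X) : TerminatesOn v T D := by
  by_contra hcon
  have hne : ∀ n, stage v T D (n + 1) ≠ stage v T D n := fun n e => hcon ⟨n, e⟩
  have hmono : StrictMono (stage v T D) := strictMono_nat_of_lt_succ fun n =>
    lt_of_le_of_ne (stage_mono D n.le_succ) (hne n).symm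
  refine Set.infinite_range_of_injective hmono.injective (hX.finite_subsets.subset ?_)
  rintro _ ⟨n, rfl⟩
  exact h n

theorem isInstance_wellOfPositivity (S : List ℕ) : IsInstance S (wellOfPositivity S) := by
  refine ⟨?_, fun A hA => hA⟩
  refine ((Set.finite_Iio S.length).image
    fun i => ((i, List.replicate (S[i]?.getD 0) ()) : Fact Unit)).subset ?_
  rintro ⟨i, l⟩ h
  have h' : S[i]? = some l.length := h
  refine ⟨i, ?_, ?_⟩
  · by_contra hi
    rw [List.getElem?_eq_none (by simpa using hi)] at h'
    cases h'
  · simp only [h', Option.getD_some]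
    exact Prod.ext rfl (List.eq_replicate_iff.2 ⟨rfl, fun _ _ => rfl⟩).symm

end Generic

end Chase

namespace CounterMachine

open Chase

/-! ## Simulation of a counter machine by Datalog rules over a bounded set of numbers -/

/-- The relation symbols of the simulation, apart from the edge relation of the chain. -/
inductive Sym : Type
  | good
  | succ
  | reg (r : ℕ)
  | st (q : ℕ)

/-- The number of a relation symbol; the number `1` is left for the edge relation. -/
def Sym.code : Sym → ℕ
  | .good => 0
  | .succ => 2
  | .reg r => 3 + 2 * r
  | .st q => 4 + 2 * q

theorem Sym.code_injective : Function.Injective Sym.code := by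
  intro a b h
  cases a <;> cases b <;> simp only [Sym.code] at h <;> first | rfl | omega | (congr 1; omega)

theorem Sym.code_ne_one (s : Sym) : s.code ≠ 1 := by
  cases s <;> simp only [Sym.code] <;> omega

/-- The critical instance contains facts for all numbers below `sigSize`, including those not used
in any rule; thus each of them still has a symbol with a meaning. -/
theorem Sym.exists_code {n : ℕ} (h : n ≠ 1) : ∃ s : Sym, s.code = n := by
  rcases Nat.even_or_odd' n with ⟨m, rfl | rfl⟩
  · match m with
    | 0 => exact ⟨.good, rfl⟩
    | 1 => exact ⟨.succ, rfl⟩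
    | m + 2 => exact ⟨.st m, by simp only [Sym.code]; omega⟩
  · match m with
    | 0 => exact absurd rfl h
    | m + 1 => exact ⟨.reg m, by simp only [Sym.code]; omega⟩

/-- An atom `R(z, u, v)` whose first argument is the distinguished variable `0`. -/
abbrev ZAtom : Type := Sym × ℕ × ℕ

/-- A Datalog rule all of whose atoms have the same first argument. -/
abbrev ZRule : Type := List ZAtom × ZAtom

def ZAtom.toAtom (a : ZAtom) : Atom := (a.1.code, [0, a.2.1, a.2.2])

def ZRule.toTGD (r : ZRule) : TGD := (r.1.map ZAtom.toAtom, [ZAtom.toAtom r.2])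

/-- The body is nonempty and contains the variables of the head other than `0`. -/
def ZRule.Safe (r : ZRule) : Prop :=
  r.1 ≠ [] ∧ ∀ x, x = r.2.2.1 ∨ x = r.2.2.2 → x = 0 ∨ ∃ a ∈ r.1, x = a.2.1 ∨ x = a.2.2

/-- The atom is true under the assignment `τ`. -/
def ZAtom.Holds (H : Sym → ℕ → ℕ → Prop) (τ : ℕ → ℕ) (a : ZAtom) : Prop :=
  H a.1 (τ a.2.1) (τ a.2.2)

/-- The rule is valid, if the variable `0` denotes the number `0`. -/
def ZRule.Valid (H : Sym → ℕ → ℕ → Prop) (r : ZRule) : Prop :=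
  ∀ τ : ℕ → ℕ, τ 0 = 0 → (∀ a ∈ r.1, ZAtom.Holds H τ a) → ZAtom.Holds H τ r.2

/-- The register that is tested or changed by an instruction. -/
def Ins.register : Ins → ℕ
  | .inc r => r
  | .dz r _ => r
  | .back _ => 0

/-- Number of registers of a machine. -/
def numRegs (M : List Ins) : ℕ := (M.map Ins.register).sum + 1

theorem register_lt {M : List Ins} {i : Ins} (h : i ∈ M) : i.register < numRegs M :=
  Nat.lt_succ_of_le (List.single_le_sum (by simp) _ (List.mem_map_of_mem h))

/-- The contents of the register `j` do not change. -/
def frame (body : List ZAtom) (j : ℕ) : ZRule := (body ++ [(.reg j, 1, 5)], (.reg j, 2, 5))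

/-- At time `1` the machine is in state `q`, and time `2` comes next. -/
def atState (q : ℕ) : List ZAtom := [(.st q, 1, 1), (.succ, 1, 2)]

/-- Variables of the instruction rules: `0` is the viewing element and thereby the number 0, `1` and
`2` are consecutive times, `4` is the successor of `3` among the register values, and `5` is a value
carried over by `frame`. -/
def zeroTest (q r : ℕ) : List ZAtom := atState q ++ [(.reg r, 1, 0)]

def posTest (q r : ℕ) : List ZAtom := atState q ++ [(.reg r, 1, 4), (.succ, 3, 4)]

/-- The rules that describe the instruction `i` at address `q` of a machine with `m` registers. -/
def insRules (m q : ℕ) : Ins → List ZRule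
  | .inc r =>
    [(atState q, (.st (q + 1), 2, 2)),
      (atState q ++ [(.reg r, 1, 3), (.succ, 3, 4)], (.reg r, 2, 4))] ++
      ((List.range m).filter (· ≠ r)).map (frame (atState q))
  | .dz r f =>
    [(zeroTest q r, (.st (q + f), 2, 2)), (posTest q r, (.st (q + 1), 2, 2)),
      (posTest q r, (.reg r, 2, 3))] ++
      (List.range m).map (frame (zeroTest q r)) ++
      ((List.range m).filter (· ≠ r)).map (frame (posTest q r))
  | .back b =>
    [(atState q, (.st (q - b), 2, 2))] ++ (List.range m).map (frame (atState q))

/-- At time `0` the machine is in state `0` and all registers but the first are empty. -/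
def initRules (m : ℕ) : List ZRule :=
  ([(.succ, 0, 1)], (.st 0, 0, 0)) ::
    ((List.range m).filter (· ≠ 0)).map fun j => ([(.succ, 0, 1)], (.reg j, 0, 0))

/-- At time `0` the first register contains `n`. -/
def startRule (n : ℕ) : ZRule :=
  ((List.range (n + 1)).map fun i => (.succ, i, i + 1), (.reg 0, 0, n))

/-- The machine is still running at the largest number. -/
def goodRules (l : ℕ) : List ZRule :=
  (List.range l).map fun q => ([(.st q, 1, 1), (.succ, 1, 1)], (.good, 0, 0))

/-- All rules that do not depend on the input. -/
def fixedRules (M : List Ins) : List ZRule :=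
  initRules (numRegs M) ++ goodRules M.length ++
    M.zipIdx.flatMap fun i => insRules (numRegs M) i.2 i.1

theorem mem_fixedRules {M : List Ins} {r : ZRule} :
    r ∈ fixedRules M ↔ r ∈ initRules (numRegs M) ∨ r ∈ goodRules M.length ∨
      ∃ q i, M[q]? = some i ∧ r ∈ insRules (numRegs M) q i := by
  simp only [fixedRules, List.mem_append, List.mem_flatMap, or_assoc, Prod.exists,
    List.mem_zipIdx_iff_getElem?]
  rw [exists_comm]

theorem safe_startRule (n : ℕ) : (startRule n).Safe := by
  refine ⟨by simp [startRule], ?_⟩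
  rintro x (h | h)
  · exact Or.inl h
  · exact Or.inr ⟨(.succ, n, n + 1), by simp [startRule], Or.inl h⟩

theorem safe_frame {body : List ZAtom} (h : ∃ a ∈ body, 2 = a.2.1 ∨ 2 = a.2.2) (j : ℕ) :
    (frame body j).Safe := by
  refine ⟨by simp [frame], ?_⟩
  obtain ⟨a, ha, h2⟩ := h
  rintro x (rfl | rfl)
  · exact Or.inr ⟨a, by simp [frame, ha], h2⟩
  · exact Or.inr ⟨(.reg j, 1, 5), by simp [frame], Or.inr rfl⟩

theorem safe_of_mem_fixedRules {M : List Ins} {r : ZRule} (h : r ∈ fixedRules M) : r.Safe := by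
  rcases mem_fixedRules.1 h with h | h | ⟨q, i, -, h⟩
  · rcases List.mem_cons.1 h with rfl | h
    · simp [ZRule.Safe]
    · obtain ⟨j, -, rfl⟩ := List.mem_map.1 h
      simp [ZRule.Safe]
  · obtain ⟨j, -, rfl⟩ := List.mem_map.1 h
    simp [ZRule.Safe]
  · cases i with
    | inc r =>
      simp only [insRules, List.mem_append, List.mem_map, List.mem_cons, List.not_mem_nil,
        or_false] at h
      rcases h with (rfl | rfl) | ⟨j, -, rfl⟩
      · simp [ZRule.Safe, atState]
      · simp [ZRule.Safe, atState]
      · exact safe_frame (by simp [atState]) j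
    | dz r f =>
      simp only [insRules, List.mem_append, List.mem_map, List.mem_cons, List.not_mem_nil,
        or_false] at h
      rcases h with ((rfl | rfl | rfl) | ⟨j, -, rfl⟩) | ⟨j, -, rfl⟩
      · simp [ZRule.Safe, zeroTest, atState]
      · simp [ZRule.Safe, posTest, atState]
      · simp [ZRule.Safe, posTest, atState]
      · exact safe_frame (by simp [zeroTest, atState]) j
      · exact safe_frame (by simp [posTest, atState]) j
    | back b =>
      simp only [insRules, List.mem_append, List.mem_map, List.mem_cons, List.not_mem_nil,
        or_false] at h
      rcases h with rfl | ⟨j, -, rfl⟩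
      · simp [ZRule.Safe, atState]
      · exact safe_frame (by simp [atState]) j

/-! ### Soundness -/

theorem trace_succ_of_getElem? {M : List Ins} {n t : ℕ} {i : Ins}
    (h : M[(trace M n t).1]? = some i) : trace M n (t + 1) = i.exec (trace M n t) := by
  rw [trace, Function.iterate_succ_apply', ← trace, next, h]

/-- Up to time `h` all values stay at most `n + h`, hence below the bound `B` at which arithmetic is
truncated. -/
theorem trace_register_le (M : List Ins) (n t r : ℕ) : (trace M n t).2 r ≤ n + t := by
  induction t generalizing r with
  | zero =>
    change Function.update (0 : ℕ → ℕ) 0 n r ≤ n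
    rw [Function.update_apply]
    split_ifs <;> simp
  | succ t ih =>
    cases hi : M[(trace M n t).1]? with
    | none =>
      rw [trace, Function.iterate_succ_apply', ← trace, next_of_none hi]
      have := ih r
      omega
    | some i =>
      rw [trace_succ_of_getElem? hi]
      have h1 := ih r
      cases i with
      | inc r' =>
        have h2 := ih r'
        simp only [Ins.exec, Function.update_apply]
        split_ifs <;> omega
      | dz r' f =>
        have h2 := ih r'
        simp only [Ins.exec]
        split_ifs
        · dsimp only
          omega
        · simp only [Function.update_apply]
          split_ifs <;> omega
      | back b =>
        simp only [Ins.exec]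
        omega

/-- The intended meaning of the symbols for the run of `M` on `n` up to the time `h`, on the
numbers up to `B` with truncated arithmetic. -/
def Sem (M : List Ins) (n h B : ℕ) : Sym → ℕ → ℕ → Prop
  | .good, _, _ => False
  | .succ, x, y => y = min (x + 1) B
  | .reg r, x, y => x ≤ h ∧ y = (trace M n x).2 r
  | .st q, x, y => x ≤ h ∧ y = x ∧ (trace M n x).1 = q

theorem valid_startRule {M : List Ins} {n h B : ℕ} (hB : n + h < B) :
    (startRule n).Valid (Sem M n h B) := by
  intro τ h0 hb
  have hτ : ∀ i ≤ n, τ i = i := by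
    intro i
    induction i with
    | zero => exact fun _ => h0
    | succ i ih =>
      intro hi
      have : Sem M n h B .succ (τ i) (τ (i + 1)) :=
        hb (.succ, i, i + 1) (List.mem_map.2 ⟨i, by simp; omega, rfl⟩)
      simp only [Sem] at this
      rw [this, ih (by omega)]
      omega
  change Sem M n h B (.reg 0) (τ 0) (τ n)
  rw [h0, hτ n le_rfl]
  exact ⟨Nat.zero_le _, rfl⟩

/-- Below `B` the truncated successor is the true one, so each rule follows one machine step. No
rule leads past time `h`, because the state there has no instruction. -/
theorem valid_of_mem_fixedRules {M : List Ins} {n h B : ℕ} (hB : n + h + 1 < B)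
    (hh : M[(trace M n h).1]? = none) {r : ZRule} (hr : r ∈ fixedRules M) :
    r.Valid (Sem M n h B) := by
  intro τ h0 hb
  rcases mem_fixedRules.1 hr with hr | hr | ⟨q, i, hi, hr⟩
  · rcases List.mem_cons.1 hr with rfl | hr
    · change Sem M n h B (.st 0) (τ 0) (τ 0)
      rw [h0]
      exact ⟨Nat.zero_le _, rfl, rfl⟩
    · obtain ⟨j, hj, rfl⟩ := List.mem_map.1 hr
      change Sem M n h B (.reg j) (τ 0) (τ 0)
      rw [h0]
      refine ⟨Nat.zero_le _, ?_⟩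
      have : j ≠ 0 := by simpa using (List.mem_filter.1 hj).2
      change 0 = Function.update (0 : ℕ → ℕ) 0 n j
      rw [Function.update_of_ne this]
      rfl
  · obtain ⟨q, -, rfl⟩ := List.mem_map.1 hr
    have h1 : Sem M n h B (.st q) (τ 1) (τ 1) := hb (.st q, 1, 1) (by simp)
    -- Only `B` is its own successor, but states are recorded only up to time `h < B`; so the body
    -- is never satisfied.
    have h2 : Sem M n h B .succ (τ 1) (τ 1) := hb (.succ, 1, 1) (by simp)
    simp only [Sem] at h1 h2
    omega
  · have step : (∀ a ∈ atState q, ZAtom.Holds (Sem M n h B) τ a) →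
        τ 1 < h ∧ τ 2 = τ 1 + 1 ∧ (trace M n (τ 1)).1 = q ∧
          trace M n (τ 2) = i.exec (trace M n (τ 1)) := by
      intro hs
      have h1 : Sem M n h B (.st q) (τ 1) (τ 1) := hs (.st q, 1, 1) (by simp [atState])
      have h2 : Sem M n h B .succ (τ 1) (τ 2) := hs (.succ, 1, 2) (by simp [atState])
      simp only [Sem] at h1 h2
      obtain ⟨h1, -, h3⟩ := h1
      have hlt : τ 1 < h := by
        refine lt_of_le_of_ne h1 fun e => ?_
        rw [e] at h3
        rw [h3, hi] at hh
        cases hh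
      have e2 : τ 2 = τ 1 + 1 := by omega
      exact ⟨hlt, e2, h3, by rw [e2, trace_succ_of_getElem? (by rw [h3, hi])]⟩
    have hle := trace_register_le M n (τ 1)
    have hframe : ∀ body j, r = frame body j → Sem M n h B (.reg j) (τ 1) (τ 5) := by
      rintro body j rfl
      exact hb (.reg j, 1, 5) (by simp [frame])
    cases i with
    | inc c =>
      obtain ⟨hlt, e2, hq, htr⟩ := step fun a ha => hb a (by
        simp only [insRules, List.mem_append, List.mem_map, List.mem_cons, List.not_mem_nil,
          or_false] at hr
        rcases hr with (rfl | rfl) | ⟨j, -, rfl⟩ <;> simp [frame, ha])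
      simp only [Ins.exec] at htr
      have hle2 : τ 2 ≤ h := by omega
      simp only [insRules, List.mem_append, List.mem_map, List.mem_cons, List.not_mem_nil,
        or_false] at hr
      rcases hr with (rfl | rfl) | ⟨j, hj, rfl⟩
      · exact ⟨hle2, rfl, by change (trace M n (τ 2)).1 = _; rw [htr, ← hq]⟩
      · have h3 : Sem M n h B (.reg c) (τ 1) (τ 3) := hb (.reg c, 1, 3) (by simp)
        have h4 : Sem M n h B .succ (τ 3) (τ 4) := hb (.succ, 3, 4) (by simp)
        simp only [Sem] at h3 h4
        refine ⟨hle2, ?_⟩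
        change τ 4 = (trace M n (τ 2)).2 c
        have := hle c
        simp only [htr, Function.update_self]
        omega
      · have h3 := hframe _ j rfl
        have hjc : j ≠ c := by simpa using (List.mem_filter.1 hj).2
        refine ⟨hle2, ?_⟩
        change τ 5 = (trace M n (τ 2)).2 j
        simp only [htr, Function.update_of_ne hjc]
        exact h3.2
    | dz c f =>
      obtain ⟨hlt, e2, hq, htr⟩ := step fun a ha => hb a (by
        simp only [insRules, List.mem_append, List.mem_map, List.mem_cons, List.not_mem_nil,
          or_false] at hr
        rcases hr with ((rfl | rfl | rfl) | ⟨j, -, rfl⟩) | ⟨j, -, rfl⟩ <;>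
          simp [frame, zeroTest, posTest, ha])
      simp only [Ins.exec] at htr
      have hle2 : τ 2 ≤ h := by omega
      have hzero : (∀ a ∈ zeroTest q c, ZAtom.Holds (Sem M n h B) τ a) →
          (trace M n (τ 1)).2 c = 0 := by
        intro hs
        have h3 : Sem M n h B (.reg c) (τ 1) (τ 0) := hs (.reg c, 1, 0) (by simp [zeroTest])
        rw [← h3.2, h0]
      have hpos : (∀ a ∈ posTest q c, ZAtom.Holds (Sem M n h B) τ a) →
          (trace M n (τ 1)).2 c = τ 3 + 1 := by
        intro hs
        have h3 : Sem M n h B (.reg c) (τ 1) (τ 4) := hs (.reg c, 1, 4) (by simp [posTest])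
        have h4 : Sem M n h B .succ (τ 3) (τ 4) := hs (.succ, 3, 4) (by simp [posTest])
        simp only [Sem] at h3 h4
        have := hle c
        omega
      simp only [insRules, List.mem_append, List.mem_map, List.mem_cons, List.not_mem_nil,
        or_false] at hr
      rcases hr with ((rfl | rfl | rfl) | ⟨j, hj, rfl⟩) | ⟨j, hj, rfl⟩
      · rw [if_pos (hzero hb)] at htr
        exact ⟨hle2, rfl, by change (trace M n (τ 2)).1 = _; rw [htr, ← hq]⟩
      · rw [if_neg (by rw [hpos hb]; omega)] at htr
        exact ⟨hle2, rfl, by change (trace M n (τ 2)).1 = _; rw [htr, ← hq]⟩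
      · have hc := hpos hb
        rw [if_neg (by omega)] at htr
        refine ⟨hle2, ?_⟩
        change τ 3 = (trace M n (τ 2)).2 c
        simp only [htr, Function.update_self]
        omega
      · have h3 := hframe _ j rfl
        rw [if_pos (hzero fun a ha => hb a (by simp [frame, ha]))] at htr
        refine ⟨hle2, ?_⟩
        change τ 5 = (trace M n (τ 2)).2 j
        simp only [htr]
        exact h3.2
      · have h3 := hframe _ j rfl
        rw [if_neg (by rw [hpos fun a ha => hb a (by simp [frame, ha])]; omega)] at htr
        have hjc : j ≠ c := by simpa using (List.mem_filter.1 hj).2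
        refine ⟨hle2, ?_⟩
        change τ 5 = (trace M n (τ 2)).2 j
        simp only [htr, Function.update_of_ne hjc]
        exact h3.2
    | back b =>
      obtain ⟨hlt, e2, hq, htr⟩ := step fun a ha => hb a (by
        simp only [insRules, List.mem_append, List.mem_map, List.mem_cons, List.not_mem_nil,
          or_false] at hr
        rcases hr with rfl | ⟨j, -, rfl⟩ <;> simp [frame, ha])
      simp only [Ins.exec] at htr
      have hle2 : τ 2 ≤ h := by omega
      simp only [insRules, List.mem_append, List.mem_map, List.mem_cons, List.not_mem_nil,
        or_false] at hr
      rcases hr with rfl | ⟨j, hj, rfl⟩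
      · exact ⟨hle2, rfl, by change (trace M n (τ 2)).1 = _; rw [htr, ← hq]⟩
      · have h3 := hframe _ j rfl
        refine ⟨hle2, ?_⟩
        change τ 5 = (trace M n (τ 2)).2 j
        simp only [htr]
        exact h3.2

/-! ### Completeness -/

/-- If the machine does not halt, then the rules prove that it is still running at the largest
number. -/
theorem good_of_not_halts {M : List Ins} {n k : ℕ} (hM : ¬ Halts M n)
    {H : Sym → ℕ → ℕ → Prop} (hS : ∀ x ≤ k, H .succ x (min (x + 1) k))
    (hstart : (startRule n).Valid H) (hfix : ∀ r ∈ fixedRules M, ZRule.Valid H r) :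
    H .good 0 0 := by
  have hins : ∀ t, ∃ i, M[(trace M n t).1]? = some i := by
    intro t
    by_contra hcon
    exact hM ⟨t, Option.eq_none_iff_forall_ne_some.2 fun i hi => hcon ⟨i, hi⟩⟩
  have hS' : ∀ x, H .succ (min x k) (min (x + 1) k) := by
    intro x
    have := hS (min x k) (min_le_right _ _)
    rwa [show min (min x k + 1) k = min (x + 1) k by omega] at this
  -- The true run, with times and values cut off at `k`, is derivable. Truncation may also allow
  -- spurious derivations, but bodies are purely positive, so these cannot block the wanted ones.
  have key : ∀ t, H (.st (trace M n t).1) (min t k) (min t k) ∧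
      ∀ r < numRegs M, H (.reg r) (min t k) (min ((trace M n t).2 r) k) := by
    intro t
    induction t with
    | zero =>
      have h01 : H .succ 0 (min 1 k) := by simpa using hS' 0
      simp only [Nat.zero_min]
      constructor
      · exact hfix ([(.succ, 0, 1)], (.st 0, 0, 0))
          (mem_fixedRules.2 (Or.inl List.mem_cons_self))
          (fun i => min i k) (by simp) (by simpa [ZAtom.Holds] using h01)
      · intro r hr
        by_cases h0 : r = 0
        · subst h0
          have := hstart (fun i => min i k) (by simp) (by
            intro a ha
            obtain ⟨i, -, rfl⟩ := List.mem_map.1 ha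
            exact hS' i)
          simpa [ZAtom.Holds, startRule, trace, start] using this
        · have := hfix ([(.succ, 0, 1)], (.reg r, 0, 0))
            (mem_fixedRules.2 (Or.inl (List.mem_cons_of_mem _
              (List.mem_map.2 ⟨r, by simp [hr, h0], rfl⟩))))
            (fun i => min i k) (by simp) (by simpa [ZAtom.Holds] using h01)
          simpa [ZAtom.Holds, trace, start, h0] using this
    | succ t ih =>
      obtain ⟨hst, hreg⟩ := ih
      obtain ⟨i, hi⟩ := hins t
      have hrule : ∀ r ∈ insRules (numRegs M) (trace M n t).1 i, ZRule.Valid H r := fun r hr =>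
        hfix r (mem_fixedRules.2 (Or.inr (Or.inr ⟨_, i, hi, hr⟩)))
      have hlt : i.register < numRegs M := register_lt (List.mem_of_getElem? hi)
      have htr := trace_succ_of_getElem? hi
      set q := (trace M n t).1
      set s := (trace M n t).2 with hs
      let τ : ℕ → ℕ → ℕ → ℕ → ℕ := fun x y w j =>
        match j with
        | 1 => min t k
        | 2 => min (t + 1) k
        | 3 => x
        | 4 => y
        | 5 => w
        | _ => 0
      have hat : ∀ x y w, ∀ a ∈ atState q, ZAtom.Holds H (τ x y w) a := by
        intro x y w a ha
        simp only [atState, List.mem_cons, List.not_mem_nil, or_false] at ha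
        rcases ha with rfl | rfl
        · exact hst
        · exact hS' t
      have hframe : ∀ body j x y, frame body j ∈ insRules (numRegs M) q i → j < numRegs M →
          (∀ w, ∀ a ∈ body, ZAtom.Holds H (τ x y w) a) →
          H (.reg j) (min (t + 1) k) (min (s j) k) := by
        intro body j x y hmem hj hbody
        refine hrule _ hmem (τ x y (min (s j) k)) rfl fun a ha => ?_
        rcases List.mem_append.1 ha with ha | ha
        · exact hbody _ a ha
        · obtain rfl := List.mem_singleton.1 ha
          exact hreg j hj
      rw [htr]
      cases i with
      | inc c =>
        simp only [Ins.exec]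
        refine ⟨hrule (atState q, (.st (q + 1), 2, 2)) (by simp [insRules]) (τ 0 0 0) rfl
          (hat _ _ _), fun r hr => ?_⟩
        by_cases hrc : r = c
        · subst hrc
          rw [Function.update_self]
          refine hrule (atState q ++ [(.reg r, 1, 3), (.succ, 3, 4)], (.reg r, 2, 4))
            (by simp [insRules]) (τ (min (s r) k) (min (s r + 1) k) 0) rfl fun a ha => ?_
          rcases List.mem_append.1 ha with ha | ha
          · exact hat _ _ _ a ha
          · simp only [List.mem_cons, List.not_mem_nil, or_false] at ha
            rcases ha with rfl | rfl
            · exact hreg r hr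
            · exact hS' (s r)
        · rw [Function.update_of_ne hrc]
          exact hframe (atState q) r 0 0 (List.mem_append_right _
            (List.mem_map_of_mem (by simp [hr, hrc]))) hr fun w => hat _ _ _
      | dz c f =>
        simp only [Ins.exec]
        change c < numRegs M at hlt
        by_cases h0 : s c = 0
        · have hzero : ∀ w, ∀ a ∈ zeroTest q c, ZAtom.Holds H (τ 0 0 w) a := by
            intro w a ha
            rcases List.mem_append.1 ha with ha | ha
            · exact hat _ _ _ a ha
            · obtain rfl := List.mem_singleton.1 ha
              have := hreg c hlt
              rwa [h0, Nat.zero_min] at this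
          rw [if_pos h0]
          refine ⟨hrule (zeroTest q c, (.st (q + f), 2, 2)) (by simp [insRules]) (τ 0 0 0) rfl
            (hzero 0), fun r hr => ?_⟩
          exact hframe (zeroTest q c) r 0 0 (List.mem_append_left _ (List.mem_append_right _
            (List.mem_map_of_mem (by simp [hr])))) hr hzero
        · have hpos : ∀ w, ∀ a ∈ posTest q c,
              ZAtom.Holds H (τ (min (s c - 1) k) (min (s c) k) w) a := by
            intro w a ha
            rcases List.mem_append.1 ha with ha | ha
            · exact hat _ _ _ a ha
            · simp only [List.mem_cons, List.not_mem_nil, or_false] at ha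
              rcases ha with rfl | rfl
              · exact hreg c hlt
              · have := hS' (s c - 1)
                rwa [Nat.sub_add_cancel (by omega)] at this
          rw [if_neg h0]
          refine ⟨hrule (posTest q c, (.st (q + 1), 2, 2)) (by simp [insRules]) _ rfl
            (hpos 0), fun r hr => ?_⟩
          change H (.reg r) (min (t + 1) k) (min (Function.update s c (s c - 1) r) k)
          by_cases hrc : r = c
          · subst hrc
            rw [Function.update_self]
            exact hrule (posTest q r, (.reg r, 2, 3)) (by simp [insRules]) _ rfl (hpos 0)
          · rw [Function.update_of_ne hrc]
            exact hframe (posTest q c) r _ _ (List.mem_append_right _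
              (List.mem_map_of_mem (by simp [hr, hrc]))) hr hpos
      | back b =>
        simp only [Ins.exec]
        refine ⟨hrule (atState q, (.st (q - b), 2, 2)) (by simp [insRules]) (τ 0 0 0) rfl
          (hat _ _ _), fun r hr => ?_⟩
        exact hframe (atState q) r 0 0 (List.mem_append_right _
          (List.mem_map_of_mem (by simp [hr]))) hr fun w => hat _ _ _
  obtain ⟨i, hi⟩ := hins k
  have hlt : (trace M n k).1 < M.length := by
    by_contra hcon
    rw [List.getElem?_eq_none (by omega)] at hi
    cases hi
  refine hfix ([(.st (trace M n k).1, 1, 1), (.succ, 1, 1)], (.good, 0, 0))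
    (mem_fixedRules.2 (Or.inr (Or.inl (List.mem_map.2 ⟨_, by simpa using hlt, rfl⟩))))
    -- At the last time `k`, which is its own truncated successor, the machine is still in a state
    -- of its program.
    (fun j => if j = 0 then 0 else k) rfl fun a ha => ?_
  simp only [List.mem_cons, List.not_mem_nil, or_false] at ha
  rcases ha with rfl | rfl
  · simpa [ZAtom.Holds] using (key k).1
  · have := hS k le_rfl
    rw [min_eq_right (Nat.le_succ k)] at this
    simpa [ZAtom.Holds] using this

end CounterMachine

namespace CounterMachine

open Chase

/-! ## The program -/

/-- A good end of the chain gets a successor. -/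
def extendRule : TGD := ([(0, [0, 0, 0])], [(1, [0, 0, 1])])

/-- Seen from `z`, its predecessor is the number `1`. -/
def succZeroRule : TGD := ([(1, [1, 1, 0])], [(2, [0, 0, 1])])

/-- Seen from any `z`, the number of the predecessor is one larger. -/
def succRule : TGD := ([(2, [0, 1, 2]), (1, [3, 3, 2])], [(2, [0, 2, 3])])

/-- A bound for the numbers of the relation symbols. -/
def sigSize (M : List Ins) : ℕ :=
  ((fixedRules M).flatMap fun r => (r.2 :: r.1).map fun a => a.1.code).sum + 4

/-- The Datalog∃ program that simulates the machine `M` on the input `n`. -/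
def program (M : List Ins) (n : ℕ) : Program :=
  (List.replicate (sigSize M) 3,
    extendRule :: succZeroRule :: succRule :: (startRule n).toTGD ::
      (fixedRules M).map ZRule.toTGD)

theorem program_rule {M : List Ins} {n i : ℕ} {r : TGD} (h : (program M n).rules[i]? = some r) :
    (i = 0 ∧ r = extendRule) ∨ r = succZeroRule ∨ r = succRule ∨
      ∃ z : ZRule, (z = startRule n ∨ z ∈ fixedRules M) ∧ r = z.toTGD := by
  match i with
  | 0 => exact Or.inl ⟨rfl, (Option.some.inj h).symm⟩
  | 1 => exact Or.inr (Or.inl (Option.some.inj h).symm)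
  | 2 => exact Or.inr (Or.inr (Or.inl (Option.some.inj h).symm))
  | 3 => exact Or.inr (Or.inr (Or.inr ⟨_, Or.inl rfl, (Option.some.inj h).symm⟩))
  | i + 4 =>
    obtain ⟨z, hz, rfl⟩ := List.mem_map.1 (List.mem_of_getElem? (i := i) h)
    exact Or.inr (Or.inr (Or.inr ⟨z, Or.inr hz, rfl⟩))

theorem exists_index {M : List Ins} {n : ℕ} {z : ZRule}
    (hz : z = startRule n ∨ z ∈ fixedRules M) : ∃ i : ℕ, (program M n).rules[i]? = some z.toTGD := by
  rcases hz with rfl | hz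
  · exact ⟨3, rfl⟩
  · obtain ⟨i, hi⟩ := List.mem_iff_getElem?.1 (List.mem_map_of_mem (f := ZRule.toTGD) hz)
    exact ⟨i + 4, hi⟩

theorem safe_of_mem {M : List Ins} {n : ℕ} {z : ZRule} (hz : z = startRule n ∨ z ∈ fixedRules M) :
    z.Safe := by
  rcases hz with rfl | hz
  · exact safe_startRule n
  · exact safe_of_mem_fixedRules hz

theorem code_lt_sigSize {M : List Ins} {n : ℕ} {z : ZRule}
    (hz : z = startRule n ∨ z ∈ fixedRules M) {a : ZAtom} (ha : a ∈ z.2 :: z.1) :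
    a.1.code < sigSize M := by
  rcases hz with rfl | hz
  · have : a.1.code < 4 := by
      rcases List.mem_cons.1 ha with rfl | ha
      · simp [startRule, Sym.code]
      · obtain ⟨i, -, rfl⟩ := List.mem_map.1 ha
        simp [Sym.code]
    exact this.trans_le (Nat.le_add_left _ _)
  · have : a.1.code ≤ ((fixedRules M).flatMap fun r => (r.2 :: r.1).map fun a => a.1.code).sum :=
      List.single_le_sum (by simp) _
        (List.mem_flatMap.2 ⟨z, hz, List.mem_map_of_mem (f := fun a : ZAtom => a.1.code) ha⟩)
    unfold sigSize
    omega

theorem singleHeadTernary_program (M : List Ins) (n : ℕ) : SingleHeadTernary (program M n) := by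
  have hsig : ∀ s < sigSize M, (program M n).sig[s]? = some 3 := fun s hs => by
    simp [program, Program.sig, hs]
  have h4 : 4 ≤ sigSize M := Nat.le_add_left _ _
  refine ⟨fun r hr => ?_, fun r hr => ?_, fun k hk => ?_⟩
  · obtain ⟨i, hi⟩ := List.mem_iff_getElem?.1 hr
    rcases program_rule hi with ⟨-, rfl⟩ | rfl | rfl | ⟨z, hz, rfl⟩
    · simp [extendRule, TGD.body, TGD.head, hsig 0 (by omega), hsig 1 (by omega)]
    · simp [succZeroRule, TGD.body, TGD.head, hsig 2 (by omega), hsig 1 (by omega)]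
    · simp [succRule, TGD.body, TGD.head, hsig 2 (by omega), hsig 1 (by omega)]
    · refine ⟨by simpa [ZRule.toTGD, TGD.body] using (safe_of_mem hz).1,
        by simp [ZRule.toTGD, TGD.head], fun a ha => ?_⟩
      have : ∃ b ∈ z.2 :: z.1, a = b.toAtom := by
        simp only [ZRule.toTGD, TGD.body, TGD.head, List.mem_append, List.mem_map,
          List.mem_singleton] at ha
        rcases ha with ⟨b, hb, rfl⟩ | rfl
        · exact ⟨b, List.mem_cons_of_mem _ hb, rfl⟩
        · exact ⟨_, List.mem_cons_self, rfl⟩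
      obtain ⟨b, hb, rfl⟩ := this
      exact hsig _ (code_lt_sigSize hz hb)
  · obtain ⟨i, hi⟩ := List.mem_iff_getElem?.1 hr
    rcases program_rule hi with ⟨-, rfl⟩ | rfl | rfl | ⟨z, hz, rfl⟩ <;> rfl
  · rw [(List.mem_replicate.1 hk).2]
    omega

/-- The elements of the chain that the chase creates from the single element of the instance. -/
def chain : ℕ → HTerm Unit
  | 0 => .const ()
  | j + 1 => .skolem 0 1 1 fun _ => chain j

/-- The only place where the variants could differ: body variables and frontier of this rule are the
same one-element list, so both produce the same term. -/
theorem extend_extendRule (v : Variant) (σ : ℕ → HTerm Unit) :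
    extend v 0 extendRule σ 0 = σ 0 ∧
      extend v 0 extendRule σ 1 = .skolem 0 1 1 fun _ => σ 0 := by
  constructor
  · rfl
  · have : ∀ args : Fin 1 → HTerm Unit, args 0 = σ 0 →
        HTerm.skolem 0 1 1 args = HTerm.skolem 0 1 1 fun _ => σ 0 := by
      intro args h
      congr 1
      funext j
      rw [Subsingleton.elim j 0, h]
    cases v
    · exact this _ rfl
    · exact this _ rfl

theorem extend_of_mem {C : Type} (v : Variant) (i : ℕ) {r : TGD} (σ : ℕ → HTerm C) {x : ℕ}
    (h : ∃ a ∈ r.body, x ∈ a.2) : extend v i r σ x = σ x :=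
  if_pos (mem_bodyVars.2 h)

/-- Safety leaves no existential variables, so these rules create no elements. -/
theorem subst_head {C : Type} (v : Variant) (i : ℕ) {z : ZRule} (hz : z.Safe)
    (σ : ℕ → HTerm C) :
    Atom.subst (extend v i z.toTGD σ) z.2.toAtom = Atom.subst σ z.2.toAtom := by
  obtain ⟨a, ha⟩ := List.exists_mem_of_ne_nil _ hz.1
  have h0 : extend v i z.toTGD σ 0 = σ 0 :=
    extend_of_mem v i σ ⟨a.toAtom, List.mem_map_of_mem ha, by simp [ZAtom.toAtom]⟩
  have hx : ∀ x, x = z.2.2.1 ∨ x = z.2.2.2 → extend v i z.toTGD σ x = σ x := by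
    intro x hx
    rcases hz.2 x hx with rfl | ⟨b, hb, hb'⟩
    · exact h0
    · refine extend_of_mem v i σ ⟨b.toAtom, List.mem_map_of_mem hb, ?_⟩
      rcases hb' with rfl | rfl <;> simp [ZAtom.toAtom]
  simp [Atom.subst, ZAtom.toAtom, h0, hx]

/-! ### Halting machines -/

/-- The position of a term in the chain. -/
def position {C : Type} : HTerm C → ℕ
  | .const _ => 0
  | .skolem _ _ 1 args => position (args 0) + 1
  | .skolem _ _ _ _ => 0

theorem position_chain (j : ℕ) : position (chain j) = j := by
  induction j with
  | zero => rfl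
  | succ j ih => simp only [chain, position, ih]

theorem chain_injective : Function.Injective chain :=
  Function.LeftInverse.injective position_chain

/-- The facts that are possible if the chain does not grow beyond `B`. -/
def Bounded (M : List Ins) (n h B : ℕ) (A : Fact (HTerm Unit)) : Prop :=
  (∃ i j, A = (1, [chain i, chain i, chain j]) ∧ i < B ∧ (j = i + 1 ∨ i = 0 ∧ j = 0)) ∨
  (∃ (s : Sym) (k i j : ℕ), A = (s.code, [chain k, chain i, chain j]) ∧
    k < B ∧ i ≤ B ∧ j ≤ B) ∨
  ∃ (s : Sym) (x y : ℕ), A = (s.code, [chain B, chain (B - x), chain (B - y)]) ∧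
    x ≤ B ∧ y ≤ B ∧ Sem M n h B s x y

theorem Bounded.edge {M : List Ins} {n h B : ℕ} {t₀ t₁ t₂ : HTerm Unit}
    (hA : Bounded M n h B (1, [t₀, t₁, t₂])) :
    ∃ i j, t₀ = chain i ∧ t₁ = chain i ∧ t₂ = chain j ∧ i < B ∧
      (j = i + 1 ∨ i = 0 ∧ j = 0) := by
  rcases hA with ⟨i, j, e, hi, hj⟩ | ⟨s, _, _, _, e, -⟩ | ⟨s, _, _, e, -⟩
  · simp only [Prod.mk.injEq, true_and, List.cons.injEq, and_true] at e
    exact ⟨i, j, e.1, e.2.1, e.2.2, hi, hj⟩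
  · exact absurd (Prod.ext_iff.1 e).1.symm s.code_ne_one
  · exact absurd (Prod.ext_iff.1 e).1.symm s.code_ne_one

theorem Bounded.sym {M : List Ins} {n h B : ℕ} {s : Sym} {t₀ t₁ t₂ : HTerm Unit}
    (hA : Bounded M n h B (s.code, [t₀, t₁, t₂])) :
    (∃ k i j, t₀ = chain k ∧ t₁ = chain i ∧ t₂ = chain j ∧ k < B ∧ i ≤ B ∧ j ≤ B) ∨
    ∃ x y, t₀ = chain B ∧ t₁ = chain (B - x) ∧ t₂ = chain (B - y) ∧ x ≤ B ∧ y ≤ B ∧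
      Sem M n h B s x y := by
  rcases hA with ⟨i, j, e, hi, hj⟩ | ⟨s', k, i, j, e, hA⟩ | ⟨s', x, y, e, hA⟩
  · exact absurd (Prod.ext_iff.1 e).1 s.code_ne_one
  · simp only [Prod.mk.injEq, List.cons.injEq, and_true] at e
    exact Or.inl ⟨k, i, j, e.2.1, e.2.2.1, e.2.2.2, hA⟩
  · simp only [Prod.mk.injEq, List.cons.injEq, and_true] at e
    obtain rfl := Sym.code_injective e.1
    exact Or.inr ⟨x, y, e.2.1, e.2.2.1, e.2.2.2, hA⟩

/-- All atoms of the rule share their first argument. If it is below `chain B`, only the bound on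
the positions has to be kept; if it is `chain B`, all body facts have the meaning `Sem`, and
validity transfers it to the head. -/
theorem Bounded.zRule {M : List Ins} {n h B : ℕ} {z : ZRule} (hz : z.Safe)
    (hv : z.Valid (Sem M n h B)) {σ : ℕ → HTerm Unit}
    (hb : ∀ a ∈ z.1, Bounded M n h B (Atom.subst σ a.toAtom)) :
    Bounded M n h B (Atom.subst σ z.2.toAtom) := by
  obtain ⟨a₀, ha₀⟩ := List.exists_mem_of_ne_nil _ hz.1
  have h0 : ∃ k ≤ B, σ 0 = chain k := by
    rcases (hb a₀ ha₀).sym with ⟨k, i, j, e, -, -, hk, -⟩ | ⟨x, y, e, -⟩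
    · exact ⟨k, hk.le, e⟩
    · exact ⟨B, le_rfl, e⟩
  obtain ⟨k, hk, hσ0⟩ := h0
  rcases hk.lt_or_eq with hk | rfl
  · have hch : ∀ x, x = z.2.2.1 ∨ x = z.2.2.2 → ∃ i ≤ B, σ x = chain i := by
      intro x hx
      rcases hz.2 x hx with rfl | ⟨a, ha, hx⟩
      · exact ⟨k, hk.le, hσ0⟩
      · rcases (hb a ha).sym with ⟨k', i, j, -, e1, e2, -, hi, hj⟩ | ⟨x', y', -, e1, e2, -⟩
        · rcases hx with rfl | rfl
          · exact ⟨i, hi, e1⟩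
          · exact ⟨j, hj, e2⟩
        · rcases hx with rfl | rfl
          · exact ⟨_, Nat.sub_le _ _, e1⟩
          · exact ⟨_, Nat.sub_le _ _, e2⟩
    obtain ⟨i, hi, ei⟩ := hch _ (Or.inl rfl)
    obtain ⟨j, hj, ej⟩ := hch _ (Or.inr rfl)
    exact Or.inr (Or.inl ⟨z.2.1, k, i, j, by simp [Atom.subst, ZAtom.toAtom, hσ0, ei, ej],
      hk, hi, hj⟩)
  -- Here `k` is the bound itself, and the number denoted by an element is its distance from the end
  -- of the chain.
  · let τ : ℕ → ℕ := fun x => k - position (σ x)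
    have hτ : ∀ x y, y ≤ k → σ x = chain (k - y) → τ x = y := by
      intro x y hy e
      simp only [τ, e, position_chain]
      omega
    have hbody : ∀ a ∈ z.1, σ a.2.1 = chain (k - τ a.2.1) ∧ σ a.2.2 = chain (k - τ a.2.2) ∧
        Sem M n h k a.1 (τ a.2.1) (τ a.2.2) := by
      intro a ha
      rcases (hb a ha).sym with ⟨k', i, j, e, -, -, hlt, -⟩ | ⟨x, y, -, e1, e2, hx, hy, hs⟩
      · have := chain_injective (hσ0.symm.trans e)
        omega
      · rw [hτ _ x hx e1, hτ _ y hy e2]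
        exact ⟨e1, e2, hs⟩
    have hτ0 : τ 0 = 0 := hτ 0 0 (Nat.zero_le _) hσ0
    have hhead : ∀ x, x = z.2.2.1 ∨ x = z.2.2.2 → σ x = chain (k - τ x) := by
      intro x hx
      rcases hz.2 x hx with rfl | ⟨a, ha, rfl | rfl⟩
      · rw [hτ0, Nat.sub_zero, hσ0]
      · exact (hbody a ha).1
      · exact (hbody a ha).2.1
    refine Or.inr (Or.inr ⟨z.2.1, τ z.2.2.1, τ z.2.2.2, ?_, Nat.sub_le _ _, Nat.sub_le _ _,
      hv τ hτ0 fun a ha => (hbody a ha).2.2⟩)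
    simp [Atom.subst, ZAtom.toAtom, hσ0, ← hhead]

theorem stage_subset_bounded (v : Variant) {M : List Ins} {n h B : ℕ} (hB : n + h + 1 < B)
    (hh : M[(trace M n h).1]? = none) (m : ℕ) :
    stage v (program M n) (wellOfPositivity (program M n).sig) m ⊆ {A | Bounded M n h B A} := by
  refine stage_subset ?_ ?_ m
  · rintro ⟨R, l⟩ hA
    have hA' : (List.replicate (sigSize M) 3)[R]? = some l.length := hA
    have hl : l.length = 3 := by
      have := List.mem_of_getElem? hA'
      exact (List.mem_replicate.1 this).2
    have el : l.map HTerm.const = [chain 0, chain 0, chain 0] := by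
      obtain ⟨a, b, c, rfl⟩ := List.length_eq_three.1 hl
      rfl
    change Bounded M n h B (R, l.map HTerm.const)
    rw [el]
    by_cases hR : R = 1
    · subst hR
      exact Or.inl ⟨0, 0, rfl, by omega, Or.inr ⟨rfl, rfl⟩⟩
    · obtain ⟨s, rfl⟩ := Sym.exists_code hR
      exact Or.inr (Or.inl ⟨s, 0, 0, 0, rfl, by omega, by omega, by omega⟩)
  · intro i r σ hi hb a ha
    rcases program_rule hi with ⟨rfl, rfl⟩ | rfl | rfl | ⟨z, hz, rfl⟩
    · obtain rfl := List.mem_singleton.1 ha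
      have h1 : Bounded M n h B (Sym.good.code, [σ 0, σ 0, σ 0]) := hb _ List.mem_cons_self
      obtain ⟨e0, e1⟩ := extend_extendRule v σ
      change Bounded M n h B (1, [extend v 0 extendRule σ 0, extend v 0 extendRule σ 0,
        extend v 0 extendRule σ 1])
      rw [e0, e1]
      -- The chain stops here: seen from `chain B`, `good` is false, so only elements below it get a
      -- successor.
      rcases h1.sym with ⟨k, _, _, e, -, -, hk, -⟩ | ⟨x, y, -, -, -, -, -, hs⟩
      · rw [e]
        exact Or.inl ⟨k, k + 1, rfl, hk, Or.inl rfl⟩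
      · exact hs.elim
    · obtain rfl := List.mem_singleton.1 ha
      have h1 : Bounded M n h B (1, [σ 1, σ 1, σ 0]) := hb _ List.mem_cons_self
      change Bounded M n h B (Sym.succ.code, [σ 0, σ 0, σ 1])
      obtain ⟨i, j, e1, -, e0, hi, hj⟩ := h1.edge
      rw [e0, e1]
      by_cases hjB : j < B
      · exact Or.inr (Or.inl ⟨.succ, j, j, i, rfl, hjB, hjB.le, hi.le⟩)
      · obtain rfl : B = i + 1 := by omega
        obtain rfl : j = i + 1 := by omega
        exact Or.inr (Or.inr ⟨.succ, 0, 1, rfl, by omega, by omega, by simp [Sem]⟩)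
    · obtain rfl := List.mem_singleton.1 ha
      have h1 : Bounded M n h B (Sym.succ.code, [σ 0, σ 1, σ 2]) := hb _ List.mem_cons_self
      have h2 : Bounded M n h B (1, [σ 3, σ 3, σ 2]) :=
        hb _ (List.mem_cons_of_mem _ List.mem_cons_self)
      change Bounded M n h B (Sym.succ.code, [σ 0, σ 2, σ 3])
      obtain ⟨i, j, e3, -, e2, hi, hj⟩ := h2.edge
      rcases h1.sym with ⟨k, _, j', e0, -, e2', hk, -, hj'⟩ | ⟨x, y, e0, -, e2', hx, hy, hs⟩
      · rw [e0, e2', e3]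
        exact Or.inr (Or.inl ⟨.succ, k, j', i, rfl, hk, hj', hi.le⟩)
      · have ej := chain_injective (e2.symm.trans e2')
        -- The predecessor `chain i` denotes `B - i`, which is `y + 1`, or `B` again if the edge is
        -- the loop at `chain 0`.
        refine Or.inr (Or.inr ⟨.succ, y, B - i, ?_, hy, Nat.sub_le _ _, ?_⟩)
        · rw [e0, e2', e3, Nat.sub_sub_self hi.le]
        · simp only [Sem]
          omega
    · obtain rfl := List.mem_singleton.1 ha
      change Bounded M n h B (Atom.subst (extend v i z.toTGD σ) z.2.toAtom)
      rw [subst_head v i (safe_of_mem hz)]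
      refine Bounded.zRule (safe_of_mem hz) ?_ fun b hb' => hb _ (List.mem_map_of_mem hb')
      rcases hz with rfl | hz
      · exact valid_startRule (by omega)
      · exact valid_of_mem_fixedRules hB hh hz

theorem Bounded.eq_chain {M : List Ins} {n h B : ℕ} {A : Fact (HTerm Unit)}
    (hA : Bounded M n h B A) : ∃ i j k, A.2 = [chain i, chain j, chain k] ∧
      i ≤ B ∧ j ≤ B ∧ k ≤ B := by
  rcases hA with ⟨i, j, rfl, hi, hj⟩ | ⟨s, k, i, j, rfl, hk, hi, hj⟩ | ⟨s, x, y, rfl, -⟩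
  · exact ⟨i, i, j, rfl, hi.le, hi.le, by omega⟩
  · exact ⟨k, i, j, rfl, hk.le, hi, hj⟩
  · exact ⟨_, _, _, rfl, le_rfl, Nat.sub_le _ _, Nat.sub_le _ _⟩

/-- A chain element nests unary terms, so a preimage is determined by the constant at its bottom. -/
theorem finite_collapse_eq_chain {C : Type} {S : Set C} (hS : S.Finite) (j : ℕ) :
    {t : HTerm C | t.Over S ∧ t.collapse = chain j}.Finite := by
  induction j with
  | zero =>
    refine (hS.image HTerm.const).subset ?_
    rintro t ⟨ht, e⟩
    cases t with
    | const c => exact ⟨c, ht, rfl⟩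
    | skolem => cases e
  | succ j ih =>
    refine (ih.image fun t => HTerm.skolem 0 1 1 fun _ => t).subset ?_
    rintro t ⟨ht, e⟩
    cases t with
    | const c => cases e
    | skolem i z k args =>
      simp only [HTerm.collapse, chain, HTerm.skolem.injEq] at e
      obtain ⟨rfl, rfl, rfl, e⟩ := e
      refine ⟨args 0, ⟨ht 0, congrFun (eq_of_heq e) 0⟩, ?_⟩
      change HTerm.skolem 0 1 1 _ = _
      congr 1
      funext i
      rw [Subsingleton.elim i 0]

/-- Every chase fact has its symbol in the signature, its constants in the given instance, and its
collapse within the bounded chain. Only finitely many facts meet these conditions. -/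
theorem allInstancesTerminate_of_halts (v : Variant) {M : List Ins} {n : ℕ} (hM : Halts M n) :
    AllInstancesTerminate v (program M n) := by
  obtain ⟨h, hh⟩ := hM
  intro C D hD
  let S : Set C := ⋃ B ∈ D, {c | c ∈ B.2}
  have hS : S.Finite := hD.1.biUnion fun B _ => B.2.finite_toSet
  let B := n + h + 2
  let F : Set (HTerm C) := ⋃ j ∈ Set.Iic B, {t : HTerm C | t.Over S ∧ t.collapse = chain j}
  have hF : F.Finite := (Set.finite_Iic B).biUnion fun j _ => finite_collapse_eq_chain hS j
  let X : Set (Fact (HTerm C)) :=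
    (fun p : ℕ × HTerm C × HTerm C × HTerm C => (p.1, [p.2.1, p.2.2.1, p.2.2.2])) ''
      (Set.Iio (sigSize M) ×ˢ F ×ˢ F ×ˢ F)
  have hX : X.Finite :=
    ((Set.finite_Iio _).prod (hF.prod (hF.prod hF))).image _
  refine terminatesOn_of_finite hX fun m A hA => ?_
  have h1 : ∀ t ∈ A.2, t.Over S := over_of_mem_stage
    (fun B hB c hc => Set.mem_biUnion hB hc) m hA
  have h2 : (List.replicate (sigSize M) 3)[A.1]? = some A.2.length :=
    stage_wellFormed (singleHeadTernary_program M n).1 hD.2 m hA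
  have h3 : Bounded M n h B (collapseFact A) :=
    stage_subset_bounded v (by omega) hh m (collapse_mem_stage hD.2 hA)
  have hlt : A.1 < sigSize M := by
    by_contra hcon
    rw [List.getElem?_eq_none (by simpa using hcon)] at h2
    cases h2
  obtain ⟨i, j, k, e, hi, hj, hk⟩ := h3.eq_chain
  obtain ⟨R, l⟩ := A
  simp only [collapseFact] at e
  have hl : l.length = 3 := by simpa using congrArg List.length e
  obtain ⟨a, b, c, rfl⟩ := List.length_eq_three.1 hl
  simp only [List.map_cons, List.map_nil, List.cons.injEq, and_true] at e
  have hmem : ∀ t ∈ [a, b, c], ∀ i ≤ B, t.collapse = chain i → t ∈ F := fun t ht i hi e =>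
    Set.mem_biUnion (Set.mem_Iic.2 hi) ⟨h1 t ht, e⟩
  exact ⟨(R, a, b, c), ⟨hlt, hmem a (by simp) i hi e.1, hmem b (by simp) j hj e.2.1,
    hmem c (by simp) k hk e.2.2⟩, rfl⟩

/-! ### Machines that do not halt -/

/-- By strong induction each `chain k` is good and gets a successor; since stage `m` contains only
terms of depth at most `m`, no stage can be final. -/
theorem not_terminatesOn_of_not_halts (v : Variant) {M : List Ins} {n : ℕ} (hM : ¬ Halts M n) :
    ¬ TerminatesOn v (program M n) (wellOfPositivity (program M n).sig) := by
  set X := result v (program M n) (wellOfPositivity (program M n).sig) with hX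
  have hbase : ∀ s < sigSize M, ((s, [chain 0, chain 0, chain 0]) : Fact (HTerm Unit)) ∈ X := by
    intro s hs
    refine Set.mem_iUnion.2 ⟨0, (s, [(), (), ()]), ?_, rfl⟩
    change (List.replicate (sigSize M) 3)[s]? = _
    simp [hs]
  have h4 : 4 ≤ sigSize M := Nat.le_add_left _ _
  have hstep : ∀ k, (∀ i < k, ((1, [chain i, chain i, chain (i + 1)]) : Fact (HTerm Unit)) ∈ X) →
      ((1, [chain k, chain k, chain (k + 1)]) : Fact (HTerm Unit)) ∈ X := by
    intro k hE
    let H : Sym → ℕ → ℕ → Prop := fun s x y =>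
      ((s.code, [chain k, chain (k - x), chain (k - y)]) : Fact (HTerm Unit)) ∈ X
    -- The truncated `0 - 1 = 0` is meant: `chain 0` is its own predecessor by the loop in the
    -- instance.
    have hpred : ∀ j ≤ k, ((1, [chain (j - 1), chain (j - 1), chain j]) : Fact (HTerm Unit)) ∈ X := by
      intro j hj
      match j with
      | 0 => exact hbase 1 (by omega)
      | j + 1 => exact hE j (by omega)
    have hS : ∀ x ≤ k, H .succ x (min (x + 1) k) := by
      intro x
      induction x with
      | zero =>
        intro _
        have := result_closed (v := v) (T := program M n) (i := 1) (r := succZeroRule)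
          (σ := fun x => if x = 0 then chain k else chain (k - 1)) rfl (by
            intro a ha
            obtain rfl := List.mem_singleton.1 ha
            exact hpred k le_rfl) (List.mem_singleton.2 rfl)
        change ((2, [chain k, chain k, chain (k - 1)]) : Fact (HTerm Unit)) ∈ X at this
        change ((2, [chain k, chain (k - 0), chain (k - min (0 + 1) k)]) : Fact (HTerm Unit)) ∈ X
        rwa [show k - min (0 + 1) k = k - 1 by omega]
      | succ x ih =>
        intro hx
        have hprev : ((2, [chain k, chain (k - x), chain (k - (x + 1))]) : Fact (HTerm Unit)) ∈ X := by
          have := ih (by omega)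
          rwa [min_eq_left hx] at this
        have := result_closed (v := v) (T := program M n) (i := 2) (r := succRule)
          (σ := fun j => match j with
            | 0 => chain k
            | 1 => chain (k - x)
            | 2 => chain (k - (x + 1))
            | _ => chain (k - (x + 1) - 1)) rfl (by
            intro a ha
            simp only [succRule, TGD.body, List.mem_cons, List.not_mem_nil, or_false] at ha
            rcases ha with rfl | rfl
            · exact hprev
            · exact hpred (k - (x + 1)) (Nat.sub_le _ _)) (List.mem_singleton.2 rfl)
        change ((2, [chain k, chain (k - (x + 1)), chain (k - (x + 1) - 1)]) : Fact (HTerm Unit)) ∈ X at this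
        change ((2, [chain k, chain (k - (x + 1)), chain (k - min (x + 1 + 1) k)]) : Fact (HTerm Unit)) ∈ X
        rwa [show k - min (x + 1 + 1) k = k - (x + 1) - 1 by omega]
    have hvalid : ∀ z : ZRule, (z = startRule n ∨ z ∈ fixedRules M) → z.Valid H := by
      intro z hz τ h0 hb
      -- Numbers are turned back into elements by `x ↦ chain (k - x)`; validity for `H` is then
      -- closure of the chase result under the rule.
      obtain ⟨i, hi⟩ := exists_index hz
      have := result_closed (v := v) (σ := fun x => chain (k - τ x)) hi (by
        intro a ha
        obtain ⟨b, hb', rfl⟩ := List.mem_map.1 ha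
        have : (b.1.code, [chain k, chain (k - τ b.2.1), chain (k - τ b.2.2)]) ∈ X := hb b hb'
        simpa [Atom.subst, ZAtom.toAtom, h0] using this) (List.mem_singleton.2 rfl)
      rw [subst_head v i (safe_of_mem hz)] at this
      change (z.2.1.code, [chain k, chain (k - τ z.2.2.1), chain (k - τ z.2.2.2)]) ∈ X
      simpa [Atom.subst, ZAtom.toAtom, h0] using this
    have hgood : H .good 0 0 :=
      good_of_not_halts hM hS (hvalid _ (Or.inl rfl)) fun r hr => hvalid r (Or.inr hr)
    have := result_closed (v := v) (T := program M n) (i := 0) (r := extendRule)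
      (σ := fun _ => chain k) rfl (by
        intro a ha
        obtain rfl := List.mem_singleton.1 ha
        exact hgood) (List.mem_singleton.2 rfl)
    obtain ⟨e0, e1⟩ := extend_extendRule v fun _ => chain k
    change ((1, [extend v 0 extendRule (fun _ => chain k) 0,
      extend v 0 extendRule (fun _ => chain k) 0,
      extend v 0 extendRule (fun _ => chain k) 1]) : Fact (HTerm Unit)) ∈ X at this
    rwa [e0, e1] at this
  have hall : ∀ k, ((1, [chain k, chain k, chain (k + 1)]) : Fact (HTerm Unit)) ∈ X := by
    intro k
    induction k using Nat.strong_induction_on with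
    | _ k ih => exact hstep k ih
  have hdepth : ∀ m k, (chain k).DepthLE m → k ≤ m := by
    intro m
    induction m with
    | zero =>
      intro k hk
      cases k with
      | zero => exact le_rfl
      | succ k => exact hk.elim
    | succ m ih =>
      intro k hk
      cases k with
      | zero => exact Nat.zero_le _
      | succ k => exact Nat.succ_le_succ (ih k (hk 0))
  rintro ⟨m, hm⟩
  -- If stage `m` were final, it would contain `chain (m + 1)`, which is too deep for it.
  obtain ⟨m', hm'⟩ := Set.mem_iUnion.1 (hall m)
  have hmem : ((1, [chain m, chain m, chain (m + 1)]) : Fact (HTerm Unit)) ∈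
      stage v (program M n) (wellOfPositivity (program M n).sig) m := by
    rcases le_total m' m with hle | hle
    · exact stage_mono _ hle hm'
    · rwa [stage_eq_of_le hm hle] at hm'
  have := hdepth m (m + 1) (depthLE_of_mem_stage hmem _ (by simp))
  omega

theorem halts_iff_allInstancesTerminate (v : Variant) (M : List Ins) (n : ℕ) :
    Halts M n ↔ AllInstancesTerminate v (program M n) :=
  ⟨allInstancesTerminate_of_halts v, fun h => by
    by_contra hM
    exact not_terminatesOn_of_not_halts v hM (h _ _ (isInstance_wellOfPositivity _))⟩

theorem halts_iff_terminatesOn (v : Variant) (M : List Ins) (n : ℕ) :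
    Halts M n ↔ TerminatesOn v (program M n) (wellOfPositivity (program M n).sig) :=
  ⟨fun h => allInstancesTerminate_of_halts v h _ _ (isInstance_wellOfPositivity _), fun h => by
    by_contra hM
    exact not_terminatesOn_of_not_halts v hM h⟩

/-! ### Computability of the reduction and undecidability -/

theorem computable_program (M : List Ins) : Computable (program M) := by
  have hbody : Primrec fun n : ℕ =>
      (List.range (n + 1)).map fun i => ((2, [0, i, i + 1]) : Atom) := by
    refine Primrec.list_map (Primrec.list_range.comp Primrec.succ) ?_
    refine Primrec.pair (Primrec.const 2) ?_
    exact Primrec.list_cons.comp (Primrec.const 0) (Primrec.list_cons.comp Primrec.snd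
      (Primrec.list_cons.comp (Primrec.succ.comp Primrec.snd) (Primrec.const [])))
  have hhead : Primrec fun n : ℕ => ([(3, [0, 0, n])] : List Atom) :=
    Primrec.list_cons.comp (Primrec.pair (Primrec.const 3)
      (Primrec.list_cons.comp (Primrec.const 0) (Primrec.list_cons.comp (Primrec.const 0)
        (Primrec.list_cons.comp Primrec.id (Primrec.const []))))) (Primrec.const [])
  have hstart : Primrec fun n => (startRule n).toTGD := by
    refine (Primrec.pair hbody hhead).of_eq fun n => ?_
    simp [startRule, ZRule.toTGD, ZAtom.toAtom, Sym.code, Function.comp_def]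
  -- Only the start rule depends on the input; the signature and all other rules are constants for
  -- the fixed machine.
  exact (Primrec.pair (Primrec.const _) (Primrec.list_cons.comp (Primrec.const _)
    (Primrec.list_cons.comp (Primrec.const _) (Primrec.list_cons.comp (Primrec.const _)
      (Primrec.list_cons.comp hstart (Primrec.const _)))))).to_comp

end CounterMachine

/-- Every recursively enumerable set reduces to the termination of the chase. -/
theorem exists_reduction_to_termination {p : ℕ → Prop} (hp : REPred p) :
    ∃ f : ℕ → Chase.Program, Computable f ∧
      ∀ n : ℕ, Chase.SingleHeadTernary (f n) ∧
        ∀ v : Chase.Variant,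
          (p n ↔ Chase.AllInstancesTerminate v (f n)) ∧
          (p n ↔ Chase.TerminatesOn v (f n) (Chase.wellOfPositivity (f n).sig)) := by
  obtain ⟨M, hM⟩ := CounterMachine.exists_machine_of_rePred hp
  refine ⟨CounterMachine.program M, CounterMachine.computable_program M, fun n =>
    ⟨CounterMachine.singleHeadTernary_program M n, fun v => ⟨?_, ?_⟩⟩⟩
  · rw [← hM n, CounterMachine.halts_iff_allInstancesTerminate v]
  · rw [← hM n, CounterMachine.halts_iff_terminatesOn v]

theorem exists_rePred_not_computablePred :
    ∃ p : ℕ → Prop, REPred p ∧ ¬ ComputablePred p := by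
  refine ⟨fun n => (Nat.Partrec.Code.eval (Denumerable.ofNat Nat.Partrec.Code n) 0).Dom, ?_, ?_⟩
  · exact (ComputablePred.halting_problem_re 0).comp (Computable.ofNat _)
  · intro h
    refine ComputablePred.halting_problem 0 ?_
    exact ComputablePred.computable_of_manyOneReducible
      ⟨Encodable.encode, Computable.encode, fun c => by simp⟩ h

theorem theorem1 :
    (∀ v : Chase.Variant,
      ¬ Chase.DecidableOn Chase.SingleHeadTernary (Chase.AllInstancesTerminate v)) ∧
    (∀ p : ℕ → Prop, REPred p →
      ∃ f : ℕ → Chase.Program, Computable f ∧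
        ∀ n : ℕ, Chase.SingleHeadTernary (f n) ∧
          ∀ v : Chase.Variant,
            (p n ↔ Chase.AllInstancesTerminate v (f n)) ∧
            (p n ↔ Chase.TerminatesOn v (f n) (Chase.wellOfPositivity (f n).sig))) := by
  refine ⟨fun v => ?_, fun p hp => exists_reduction_to_termination hp⟩
  rintro ⟨Q, hQ, hQK⟩
  obtain ⟨p, hp, hnp⟩ := exists_rePred_not_computablePred
  obtain ⟨f, hf, hfp⟩ := exists_reduction_to_termination hp
  -- The reduction takes values in the admissible class, where `Q` agrees with termination, so a
  -- computable `Q` would decide `p`.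
  exact hnp (ComputablePred.computable_of_manyOneReducible
    ⟨f, hf, fun n => ((hfp n).2 v).1.trans (hQK _ (hfp n).1).symm⟩ hQ)
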